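/- Let $\beta>0$, let $p\ge1$ be the integer with $p-1<\beta\le p$ (so $p-1=\lfloor\beta\rfloor$, the greatest integer strictly less than $\beta$), let $L>0$, $r>0$, $x\in(0,1)$, and let $\Sigma(\beta,L)$ be the class of functions $f$ on $[0,1]$ that are $p-1$ times differentiable with $|f^{(p-1)}(s)-f^{(p-1)}(t)|\le L|s-t|^{\beta-p+1}$. **Model and estimator.** For each $n$ one observes $Y_i=f(X_i)+\sigma_{0,i}\varepsilon_i$, $i=1,\dots,n$, with deterministic $X_i\in[0,1]$ and independent standard normal $\varepsilon_i$; $\mathbb E$ is the expectation in this model. The working model is $Y\sim N(\Psi^\top\theta,\Sigma)$, where $\Sigma=\mathrm{diag}(\sigma_1^2,\dots,\sigma_n^2)$ and $\Psi$ is the $p\times n$ matrix with columns $\Psi_i=(1,X_i-x,\dots,(X_i-x)^{p-1}/(p-1)!)^\top$. Given scales $k=1,\dots,K$ with bandwidths $\frac1{2n}\le h_1<\dots<h_K\le1$ and weights $w_{k,i}\in[0,1]$, put $\mathcal W_k=\mathrm{diag}(w_{k,i}/\sigma_i^2)$, $B_k=\Psi\mathcal W_k\Psi^\top$, $\tilde\theta_k=B_k^{-1}\Psi\mathcal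 W_kY$, $\theta^*_k=\mathbb E\tilde\theta_k$, $T_{lm}=(\tilde\theta_l-\tilde\theta_m)^\top B_l(\tilde\theta_l-\tilde\theta_m)$. For critical values $\mathfrak z_1,\dots,\mathfrak z_{K-1}$ let $$\hat k=\max\{k\le K: T_{lm}\le\mathfrak z_l\text{ for all } l<m\le k\},\qquad \hat\theta_k=\tilde\theta_{\min(k,\hat k)},\qquad \hat f(x)=e_1^\top\tilde\theta_{\hat k}.$$ All quantities $K,X_i,h_k,w_{k,i},\sigma_i,\sigma_{0,i},\mathfrak z_k$ may depend on $n$. **Assumptions.** Let $0<\sigma_{\min}^2\le\sigma_{\max}^2$, $\lambda_0,a_0>0$, $w_{\max}$, $1<u_0\le u$, $\alpha\in(0,1]$, $\mu\in(0,1/4)$, $s_1,C_w,c_H>0$ be constants independent of $n$, and $\delta_n\in[0,1)$ with $\delta_n=o(1/\log n)$. For all sufficiently large $n$: * (S) $1-\delta_n\le\sigma_{0,i}^2/\sigma_i^2\le1+\delta_n$; (S1) $\sigma_{\min}^2\le\sigma_i^2\le\sigma_{\max}^2$; * (B) $u_0B_{k-1}\preceq B_k\preceq uB_{k-1}$ for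 $2\le k\le K$; (D) $\Psi$ has rank $p$; (Loc) at least $p$ indices $i$ have $w_{1,i}>0$; (W) $w_{l,i}\le w_{m,i}$, and moreover $w_{l,i}w_{m,i}=w_{l,i}$, for $l\le m$; * (Lp1') the smallest eigenvalue of $H_k^{-1}B_kH_k^{-1}$ is at least $nh_k\lambda_0/\sigma_{\max}^2$ for all $k$, where $H_k=\mathrm{diag}(1,h_k,\dots,h_k^{p-1})$; (Lp2') $\frac1n\#\{i:X_i\in A\}\le a_0\max\{|A|,\frac1n\}$ for every interval $A\subseteq[0,1]$; (Lp3') $w_{k,i}=0$ if $|X_i-x|>h_k$; (Lp4') $|w_{k,i}|\le w_{\max}$; * (PC) $\mathbb E_{0,\Sigma}|(\tilde\theta_k-\hat\theta_k)^\top B_k(\tilde\theta_k-\hat\theta_k)|^r\le\alpha\, C(p,r)$ for $2\le k\le K$, where $\mathbb E_{0,\Sigma}$ is the expectation under $Y\sim N(0,\Sigma)$ and $C(p,r)=2^r\Gamma(r+p/2)/\Gamma(p/2)$; and the critical values do not exceed the theoretical ones: $$\mathfrak z_k\le\tfrac4\mu\Big\{r(K-k)\log u+\log\tfrac K\alpha-\tfrac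 p4\log(1-4\mu)-\log(1-u^{-r})+\log\tfrac{2^{2r}[\Gamma(2r+p/2)\Gamma(p/2)]^{1/2}}{\Gamma(r+p/2)}\Big\},\quad 1\le k<K;$$ * the largest bandwidth satisfies $h_K\ge c_H n^{-1/(2\beta+1)}$. For a function $f$ put $\bar b_{k,f}=\max_{l\le k}|e_1^\top\theta^*_l-f(x)|$, $\sigma_k^2=\mathrm{Var}(e_1^\top\tilde\theta_k)$ (true model) and $k^\star=\max\{k\le K:\bar b_{k,f}\le C_w\sigma_k\}$, and let $\mathcal F_n$ be the set of $f\in\Sigma(\beta,L)$ such that * the first scale is accepted, i.e. $\bar b_{1,f}\le C_w\sigma_1$ (so that $k^\star$ exists); * (S$k^\star$1) $\mathbf\Sigma_{k^\star,1}^{-1}\preceq s_1\mathbf\Sigma_{k^\star,1,\mathrm{diag}}^{-1}$, where $\mathbf\Sigma_{k,1}$ is the covariance matrix of $(e_1^\top\tilde\theta_1,\dots,e_1^\top\tilde\theta_k)$ in the working model and $\mathbf\Sigma_{k,1,\mathrm{diag}}$ is its diagonal part. **Conclusion.** With $\gamma=\frac{2\beta+1}{2\beta}$, for all sufficiently large $n$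 and all $f\in\mathcal F_n$, $$\mathbb E|f(x)-\hat f(x)|^r\le C\,L^{\frac r{2\beta+1}}\Big(\frac{\log^\gamma n}{n}\Big)^{\frac{r\beta}{2\beta+1}}(1+o(1)),\qquad n\to\infty,$$ where $C$ depends only on $r,\beta,p,\sigma_{\min}^2,\sigma_{\max}^2,w_{\max},\lambda_0,a_0$, and the $o(1)$ term does not depend on $f$. -/

import Mathlib

open MeasureTheory ProbabilityTheory Filter Topology Asymptotics
open scoped NNReal ENNReal Nat Matrix

noncomputable section

namespace LocPoly

/-- The Hölder class `Σ(β, L)` on `[0,1]`: `f` is `ℓ` times differentiable on `[0,1]` and its `ℓ`-th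
derivative is Hölder continuous with exponent `β - ℓ` and constant `L`, where `ℓ` is the greatest
integer strictly less than `β`. -/
def HolderClass (ℓ : ℕ) (β L : ℝ) : Set (ℝ → ℝ) :=
  {f | (∀ j < ℓ, DifferentiableOn ℝ (iteratedDerivWithin j f (Set.Icc 0 1)) (Set.Icc 0 1)) ∧
    ∀ s ∈ Set.Icc (0 : ℝ) 1, ∀ t ∈ Set.Icc (0 : ℝ) 1,
      |iteratedDerivWithin ℓ f (Set.Icc 0 1) s - iteratedDerivWithin ℓ f (Set.Icc 0 1) t|
        ≤ L * |s - t| ^ (β - ℓ)}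

/-- `C(p, r) = E|χ²_p|^r`. -/
def chiSqMoment (p : ℕ) (r : ℝ) : ℝ :=
  2 ^ r * Real.Gamma (r + p / 2) / Real.Gamma (p / 2)

/-- The theoretical critical values
`(4/μ) {r (K - k) log u + log (K/α) - (p/4) log (1 - 4μ) - log (1 - u^{-r}) + C̄(p,r)}`. -/
def theoreticalCrit (p : ℕ) (r α μ u : ℝ) (K k : ℕ) : ℝ :=
  4 / μ * (r * ((K : ℝ) - k) * Real.log u + Real.log (K / α) - p / 4 * Real.log (1 - 4 * μ)
    - Real.log (1 - u ^ (-r))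
    + Real.log (2 ^ (2 * r) * Real.sqrt (Real.Gamma (2 * r + p / 2) * Real.Gamma (p / 2))
        / Real.Gamma (r + p / 2)))

/-- Everything that is fixed for sample size `n` and reference point `x`, except for the regression
function. Scales are numbered `1, …, K`; critical values are `z 1, …, z (K - 1)`. -/
structure Scheme (n : ℕ) where
  /-- number of scales -/
  K : ℕ
  /-- design points -/
  X : Fin n → ℝ
  /-- bandwidths `h_k` -/
  h : ℕ → ℝ
  /-- localizing weights `w_{k,i}(x)` -/
  w : ℕ → Fin n → ℝ
  /-- variances `σ_i²` of the approximate model (known to the statistician) -/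
  varModel : Fin n → ℝ≥0
  /-- true variances `σ_{0,i}²` -/
  varTrue : Fin n → ℝ≥0
  /-- critical values -/
  z : ℕ → ℝ

namespace Scheme

variable {n : ℕ} (S : Scheme n) (ℓ : ℕ) (x : ℝ)

/-! ### Local polynomial (quasi maximum likelihood) estimators of order `ℓ = p - 1` -/

/-- The `p × n` design matrix with columns `(1, X_i - x, …, (X_i - x)^{p-1}/(p-1)!)`. -/
def Psi : Matrix (Fin (ℓ + 1)) (Fin n) ℝ :=
  Matrix.of fun j i => (S.X i - x) ^ (j : ℕ) / ((j : ℕ)! : ℝ)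

/-- `W_k = diag(w_{k,i} / σ_i²)`. -/
def W (k : ℕ) : Matrix (Fin n) (Fin n) ℝ :=
  Matrix.diagonal fun i => S.w k i / (S.varModel i : ℝ)

/-- `B_k = Ψ W_k Ψᵀ`. -/
def B (k : ℕ) : Matrix (Fin (ℓ + 1)) (Fin (ℓ + 1)) ℝ :=
  S.Psi ℓ x * S.W k * (S.Psi ℓ x)ᵀ

/-- The local polynomial estimator `θ̃_k = B_k⁻¹ Ψ W_k Y`. -/
def qmle (k : ℕ) (y : Fin n → ℝ) : Fin (ℓ + 1) → ℝ :=
  (S.B ℓ x k)⁻¹ *ᵥ ((S.Psi ℓ x * S.W k) *ᵥ y)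

/-- The local quasi log-likelihood `L(W_k, θ)`, up to a term that does not depend on `θ`. -/
def logLik (k : ℕ) (θ : Fin (ℓ + 1) → ℝ) (y : Fin n → ℝ) : ℝ :=
  -(1 / 2) * ∑ i, (y i - ((S.Psi ℓ x)ᵀ *ᵥ θ) i) ^ 2 * (S.w k i / (S.varModel i : ℝ))

/-- The fitted log-likelihood statistic `T_{lm} = 2 L(W_l, θ̃_l, θ̃_m)`. -/
def T (l m : ℕ) (y : Fin n → ℝ) : ℝ :=
  2 * (S.logLik ℓ x l (S.qmle ℓ x l y) y - S.logLik ℓ x l (S.qmle ℓ x m y) y)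

/-- Lepski's selection rule `k̂ = max {k ≤ K : T_{lm} ≤ z_l for all l < m ≤ k}`. -/
def khat (y : Fin n → ℝ) : ℕ :=
  sSup {k | 1 ≤ k ∧ k ≤ S.K ∧ ∀ l m, 1 ≤ l → l < m → m ≤ k → S.T ℓ x l m y ≤ S.z l}

/-- The last accepted estimator after `k` steps, `θ̂_k = θ̃_{min(k, k̂)}`. -/
def lastAccepted (k : ℕ) (y : Fin n → ℝ) : Fin (ℓ + 1) → ℝ :=
  S.qmle ℓ x (min k (S.khat ℓ x y)) y

/-- The adaptive local polynomial estimator `f̂(x) = e₁ᵀ θ̃_{k̂}`. -/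
def fhat (y : Fin n → ℝ) : ℝ :=
  S.qmle ℓ x (S.khat ℓ x y) y 0

/-! ### Distributions of the observations -/

/-- The law of `Y_i = f(X_i) + σ_{0,i} ε_i` with independent standard normal `ε_i`. -/
def trueLaw (f : ℝ → ℝ) : Measure (Fin n → ℝ) :=
  Measure.pi fun i => gaussianReal (f (S.X i)) (S.varTrue i)

/-- The centred law `N(0, Σ)` of the approximate model. -/
def nullLaw : Measure (Fin n → ℝ) :=
  Measure.pi fun i => gaussianReal 0 (S.varModel i)

/-! ### Bias, variance and the oracle index -/

/-- `b_{k,f}(x) = e₁ᵀ θ*_k - f(x)` with `θ*_k = B_k⁻¹ Ψ W_k (f(X_1), …, f(X_n))ᵀ`. -/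
def bias (f : ℝ → ℝ) (k : ℕ) : ℝ :=
  S.qmle ℓ x k (fun i => f (S.X i)) 0 - f x

/-- `sup_{1 ≤ l ≤ k} |b_{l,f}(x)|`. -/
def supBias (f : ℝ → ℝ) (k : ℕ) : ℝ :=
  ⨆ l : Set.Icc 1 k, |S.bias ℓ x f l|

/-- `σ_k(x)`, the standard deviation of `e₁ᵀ θ̃_k` under the true law. -/
def stdDev (f : ℝ → ℝ) (k : ℕ) : ℝ :=
  Real.sqrt (variance (fun y => S.qmle ℓ x k y 0) (S.trueLaw f))

/-- The index `k⋆` of the ideal bandwidth: the largest `k ≤ K` for which the bias does not exceed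
`Cw` times the standard deviation. -/
def oracleIndex (f : ℝ → ℝ) (Cw : ℝ) : ℕ :=
  sSup {k | 1 ≤ k ∧ k ≤ S.K ∧ S.supBias ℓ x f k ≤ Cw * S.stdDev ℓ x f k}

/-- The covariance matrix of `e₁ᵀ θ̃_1, …, e₁ᵀ θ̃_k` in the approximate model. (It does not depend on
the mean, which is therefore taken to be zero.) -/
def covFirst (k : ℕ) : Matrix (Fin k) (Fin k) ℝ :=
  Matrix.of fun l m =>
    covariance (fun y => S.qmle ℓ x ((l : ℕ) + 1) y 0)
      (fun y => S.qmle ℓ x ((m : ℕ) + 1) y 0) S.nullLaw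

/-! ### The conditions; `A ≼ B` for symmetric matrices is written `(B - A).PosSemidef` -/

/-- Design points in `[0,1]`, weights in `[0,1]`, increasing bandwidths
`1/(2n) ≤ h_1 < … < h_K ≤ 1`. -/
def CondBasic : Prop :=
  1 ≤ S.K ∧ (∀ i, S.X i ∈ Set.Icc (0 : ℝ) 1) ∧
    (∀ k ∈ Finset.Icc 1 S.K, ∀ i, S.w k i ∈ Set.Icc (0 : ℝ) 1) ∧
    1 / (2 * (n : ℝ)) ≤ S.h 1 ∧ S.h S.K ≤ 1 ∧ StrictMonoOn S.h (Set.Icc 1 S.K)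

/-- `(B)`. As `B_{k-1}` is positive definite, `u₀ I ≼ B_{k-1}^{-1/2} B_k B_{k-1}^{-1/2} ≼ u I` is
the same as `u₀ B_{k-1} ≼ B_k ≼ u B_{k-1}`. -/
def CondB (u₀ u : ℝ) : Prop :=
  ∀ k, 2 ≤ k → k ≤ S.K →
    (S.B ℓ x k - u₀ • S.B ℓ x (k - 1)).PosSemidef ∧
    (u • S.B ℓ x (k - 1) - S.B ℓ x k).PosSemidef

/-- `(D)`: the design matrix has full row rank. -/
def CondD : Prop := (S.Psi ℓ x).rank = ℓ + 1

/-- `(Loc)`: at least `p` design points carry a positive weight on the smallest scale. -/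
def CondLoc : Prop := ℓ + 1 ≤ {i | 0 < S.w 1 i}.ncard

/-- The propagation conditions `(PC)`. -/
def CondPC (r α : ℝ) : Prop :=
  ∀ k, 2 ≤ k → k ≤ S.K →
    ∫⁻ y, ENNReal.ofReal
        (|(S.qmle ℓ x k y - S.lastAccepted ℓ x k y) ⬝ᵥ
            (S.B ℓ x k *ᵥ (S.qmle ℓ x k y - S.lastAccepted ℓ x k y))| ^ r) ∂S.nullLaw
      ≤ ENNReal.ofReal (α * chiSqMoment (ℓ + 1) r)

/-- The critical values do not exceed the theoretical ones. -/
def CondCrit (r α μ u : ℝ) : Prop :=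
  ∀ k, 1 ≤ k → k < S.K → S.z k ≤ theoreticalCrit (ℓ + 1) r α μ u S.K k

/-- `(S)`: relative misspecification of the variances. -/
def CondS (δ : ℝ) : Prop :=
  ∀ i, 1 - δ ≤ (S.varTrue i : ℝ) / S.varModel i ∧ (S.varTrue i : ℝ) / S.varModel i ≤ 1 + δ

/-- `(S1)`, with `vmin = σ_min²` and `vmax = σ_max²`. -/
def CondS1 (vmin vmax : ℝ) : Prop :=
  ∀ i, vmin ≤ (S.varModel i : ℝ) ∧ (S.varModel i : ℝ) ≤ vmax

/-- `(Lp1')`, in the scale-invariant form: with `H_k = diag(1, h_k, …, h_k^{p-1})` the smallest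
eigenvalue of `H_k⁻¹ B_k H_k⁻¹` is at least `n h_k λ₀ / σ_max²`. As `0 < h_k ≤ 1`, it follows from
the same bound for the smallest eigenvalue of `B_k` itself, and agrees with it for `p = 1`. -/
def CondLp1 (lam₀ vmax : ℝ) : Prop :=
  ∀ k ∈ Finset.Icc 1 S.K,
    (S.B ℓ x k - (n * S.h k * lam₀ / vmax) •
      Matrix.diagonal fun j : Fin (ℓ + 1) => (S.h k ^ (j : ℕ)) ^ 2).PosSemidef

/-- `(Lp2')`; closed intervals suffice, since an interval and its closure have the same length. -/
def CondLp2 (a₀ : ℝ) : Prop :=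
  ∀ a b : ℝ, 0 ≤ a → a ≤ b → b ≤ 1 →
    1 / (n : ℝ) * {i | S.X i ∈ Set.Icc a b}.ncard ≤ a₀ * max (b - a) (1 / (n : ℝ))

/-- `(Lp3')`. -/
def CondLp3 : Prop :=
  ∀ k ∈ Finset.Icc 1 S.K, ∀ i, S.h k < |S.X i - x| → S.w k i = 0

/-- `(Lp4')`. -/
def CondLp4 (wmax : ℝ) : Prop :=
  ∀ k ∈ Finset.Icc 1 S.K, ∀ i, |S.w k i| ≤ wmax

/-- The ordering condition `(W)`. -/
def CondW : Prop :=
  ∀ l m, 1 ≤ l → l ≤ m → m ≤ S.K → ∀ i, S.w l i ≤ S.w m i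

/-- `w_{l,i} w_{m,i} = w_{l,i}` for `l ≤ m`. -/
def CondProd : Prop :=
  ∀ l m, 1 ≤ l → l ≤ m → m ≤ S.K → ∀ i, S.w l i * S.w m i = S.w l i

/-- The first estimator is accepted: scale `1` meets the relation that defines the oracle index. -/
def FirstAccepted (f : ℝ → ℝ) (Cw : ℝ) : Prop :=
  S.supBias ℓ x f 1 ≤ Cw * S.stdDev ℓ x f 1

/-- `(Skj)` for a scale `k` and `j = 1`: `Σ_{k,1}⁻¹ ≼ s Σ_{k,1,diag}⁻¹`. -/
def CondSk1 (s : ℝ) (k : ℕ) : Prop :=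
  (s • (Matrix.diagonal (S.covFirst ℓ x k).diag)⁻¹ - (S.covFirst ℓ x k)⁻¹).PosSemidef

end Scheme

end LocPoly

end

/-! The risk is analysed at a deterministic reference scale `k`: the largest one with `n h_k^(2β+1)
L² ≤ M`, or `k = 1` if there is none. Let `κ` bound from below the information about `f(x)` at scale
`k`, and put `ρ = L^(1/(2β+1)) n^(-β/(2β+1))`. The error splits into three parts (`risk_le`). (1)
Selected minus last accepted estimator: it vanishes if `k̂ ≤ k`; otherwise the test of `k` against
`k̂` was passed, so it is at most `√(z_k/κ)`, and `z_k = O(log n)`. (2) Estimator at scale `k` minus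
last accepted one: the propagation condition controls it under `N(0, Σ)`, and a change of measure
transfers this to the true law (`lintegral_propagationStat_le`). The difference ignores polynomial
trends, so only the Taylor remainder acts as mean; it depends on the data through `k p` linear
functionals, so the squared likelihood ratio costs at most `exp(energy/(1-δ)) (1-δ²)^(-kp/2)`. This
is bounded because `K = O(log n)` and `δ = o(1/log n)`. (3) Estimator at scale `k` minus `f(x)`:
Gaussian, with bias and standard deviation `O(κ^(-1/2))`. If `k < K`, failure of the bandwidth
condition at `k + 1` together with `B_{k+1} ≼ u B_k` gives `κ^(-1/2) ≤ Q₁ ρ`, with `Q₁` as small as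
desired once `M` is large. If `k = K`, the lower bound on `h_K` gives `κ^(-1/2) = O(ρ)` and part (1)
is absent. Only part (1) carries the logarithm and `M` enters only the other two constants, so for
large `n` the bound holds with `C = 1` and a zero `o(1)` term. -/

/-! ### Linear images and likelihood ratios of product Gaussian laws -/

section GaussianProducts

variable {ι κ : Type*} [Fintype ι] [Fintype κ]

/-- Linear functionals that are pairwise orthogonal with respect to the covariance of a product of
Gaussian laws are independent Gaussian. -/
lemma map_pi_gaussianReal_of_orthogonal [DecidableEq κ] (a : κ → ι → ℝ) (m : ι → ℝ) (s : ι → ℝ≥0)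
    (t : κ → ℝ≥0) (h : ∀ j j', ∑ i, a j i * a j' i * s i = if j = j' then (t j : ℝ) else 0) :
    (Measure.pi fun i => gaussianReal (m i) (s i)).map (fun y j => ∑ i, a j i * y i)
      = Measure.pi fun j => gaussianReal (∑ i, a j i * m i) (t j) := by
  have hmeas : Measurable (fun (y : ι → ℝ) j => ∑ i, a j i * y i) := by fun_prop
  have : IsProbabilityMeasure ((Measure.pi fun i => gaussianReal (m i) (s i)).map
      (fun y j => ∑ i, a j i * y i)) :=
    Measure.isProbabilityMeasure_map hmeas.aemeasurable
  rw [← charFun_eq_pi_iff]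
  intro ξ
  -- The characteristic function of a linear image is the original one at the transposed argument;
  -- in the resulting quadratic form orthogonality removes the cross terms.
  have key : charFun (((Measure.pi fun i => gaussianReal (m i) (s i)).map
      (fun y j => ∑ i, a j i * y i)).map (WithLp.toLp 2)) ξ
      = charFun ((Measure.pi fun i => gaussianReal (m i) (s i)).map (WithLp.toLp 2))
        (WithLp.toLp 2 fun i => ∑ j, a j i * ξ j) := by
    simp_rw [charFun, ← MeasurableEquiv.coe_toLp, integral_map_equiv]
    rw [integral_map hmeas.aemeasurable]
    · congr 1
      ext y
      congr 2
      simp only [MeasurableEquiv.coe_toLp, PiLp.inner_apply, RCLike.inner_apply, conj_trivial,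
        Finset.mul_sum, Finset.sum_mul]
      rw [Finset.sum_comm]
      push_cast
      exact Finset.sum_congr rfl fun _ _ => Finset.sum_congr rfl fun _ _ => by ring
    · refine Continuous.aestronglyMeasurable ?_
      simp only [MeasurableEquiv.coe_toLp]
      fun_prop
  rw [key, charFun_pi]
  simp_rw [charFun_gaussianReal, ← Complex.exp_sum]
  congr 1
  rw [Finset.sum_sub_distrib, Finset.sum_sub_distrib]
  congr 1
  · simp only [Complex.ofReal_sum, Finset.sum_mul, Finset.mul_sum, Complex.ofReal_mul]
    rw [Finset.sum_comm]
    exact Finset.sum_congr rfl fun _ _ => Finset.sum_congr rfl fun _ _ => by ring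
  · norm_cast
    rw [← Finset.sum_div, ← Finset.sum_div]
    congr 1
    have : ∀ i, (s i : ℝ) * (∑ j, a j i * ξ j) ^ 2
        = ∑ j, ∑ j', ξ j * ξ j' * (a j i * a j' i * s i) := fun i => by
      rw [sq, Finset.sum_mul_sum, Finset.mul_sum]
      refine Finset.sum_congr rfl fun _ _ => ?_
      rw [Finset.mul_sum]
      exact Finset.sum_congr rfl fun _ _ => by ring
    simp_rw [this]
    rw [Finset.sum_comm]
    refine Finset.sum_congr rfl fun j _ => ?_
    rw [Finset.sum_comm]
    simp_rw [← Finset.mul_sum, h]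
    simp
    ring

lemma map_pi_gaussianReal_sum (a : ι → ℝ) (m : ι → ℝ) (s : ι → ℝ≥0) :
    (Measure.pi fun i => gaussianReal (m i) (s i)).map (fun y => ∑ i, a i * y i)
      = gaussianReal (∑ i, a i * m i) (∑ i, (a i ^ 2).toNNReal * s i) := by
  have h := map_pi_gaussianReal_of_orthogonal (κ := Unit) (fun _ => a) m s
    (fun _ => ∑ i, (a i ^ 2).toNNReal * s i) (fun j j' => by
      simp [mul_self_nonneg, sq])
  have h2 := congrArg (Measure.map (fun z : Unit → ℝ => z ())) h
  rw [Measure.map_map (by fun_prop) (by fun_prop)] at h2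
  rw [(measurePreserving_eval _ ()).map_eq] at h2
  exact h2

/-- The likelihood ratio of `N(m, s)` with respect to the standard normal law. -/
noncomputable def gaussianRatio (m : ℝ) (s : ℝ≥0) (x : ℝ) : ℝ≥0∞ :=
  gaussianPDF m s x / gaussianPDF 0 1 x

lemma measurable_gaussianRatio (m : ℝ) (s : ℝ≥0) : Measurable (gaussianRatio m s) :=
  (measurable_gaussianPDF _ _).div (measurable_gaussianPDF _ _)

lemma withDensity_gaussianRatio (m : ℝ) {s : ℝ≥0} (hs : s ≠ 0) :
    (gaussianReal 0 1).withDensity (gaussianRatio m s) = gaussianReal m s := by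
  rw [gaussianReal_of_var_ne_zero _ one_ne_zero, gaussianReal_of_var_ne_zero _ hs,
    ← withDensity_mul _ (measurable_gaussianPDF _ _) (measurable_gaussianRatio m s)]
  congr 1
  ext x
  exact ENNReal.mul_div_cancel (gaussianPDF_pos 0 one_ne_zero x).ne' gaussianPDF_ne_top

/-- Completing the square in `-(x-m)²/s + x²/2` leaves a Gaussian density with mean `2m/(2-s)` and
variance `s/(2-s)`, which is integrable because `s < 2`. -/
lemma lintegral_gaussianRatio_sq (m : ℝ) {s : ℝ≥0} (hs : s ≠ 0) (hs2 : (s : ℝ) < 2) :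
    ∫⁻ x, gaussianRatio m s x ^ 2 ∂gaussianReal 0 1
      = ENNReal.ofReal (Real.exp (m ^ 2 / (2 - s)) / Real.sqrt (s * (2 - s))) := by
  have hs0 : (0 : ℝ) < s := by positivity
  have h2s : (0 : ℝ) < 2 - s := by linarith
  have hv : Real.toNNReal (s / (2 - s)) ≠ 0 := by
    simpa using div_pos hs0 h2s
  rw [gaussianReal_of_var_ne_zero _ one_ne_zero, lintegral_withDensity_eq_lintegral_mul _
    (measurable_gaussianPDF _ _) ((measurable_gaussianRatio m s).pow_const 2)]
  have key : ∀ x, (gaussianPDF 0 1 * fun x => gaussianRatio m s x ^ 2) x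
      = ENNReal.ofReal (Real.exp (m ^ 2 / (2 - s)) / Real.sqrt (s * (2 - s)))
        * gaussianPDF (2 * m / (2 - s)) (Real.toNNReal (s / (2 - s))) x := by
    intro x
    simp only [Pi.mul_apply, gaussianRatio, gaussianPDF]
    have h1 := gaussianPDFReal_pos 0 1 x one_ne_zero
    rw [← ENNReal.ofReal_div_of_pos h1, ← ENNReal.ofReal_pow (by
      have := gaussianPDFReal_nonneg m s x; positivity), ← ENNReal.ofReal_mul h1.le,
      ← ENNReal.ofReal_mul (by positivity)]
    congr 1
    rw [div_pow, sq (gaussianPDFReal 0 1 x), ← mul_div_assoc, mul_div_mul_left _ _ h1.ne']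
    rw [div_eq_iff h1.ne']
    simp only [gaussianPDFReal]
    rw [Real.coe_toNNReal _ (by positivity)]
    have e1 : Real.sqrt (2 * Real.pi * s) = Real.sqrt (2 * Real.pi) * Real.sqrt s :=
      Real.sqrt_mul (by positivity) _
    have e2 : Real.sqrt (2 * Real.pi * (s / (2 - s)))
        = Real.sqrt (2 * Real.pi) * (Real.sqrt s / Real.sqrt (2 - s)) := by
      rw [Real.sqrt_mul (by positivity), Real.sqrt_div' _ h2s.le]
    have e3 : Real.sqrt (s * (2 - s)) = Real.sqrt s * Real.sqrt (2 - s) :=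
      Real.sqrt_mul hs0.le _
    rw [e1, e2, e3]
    have hp : 0 < Real.sqrt (2 * Real.pi) := by positivity
    have h3 : 0 < Real.sqrt s := by positivity
    have h4 : 0 < Real.sqrt (2 - s) := by positivity
    have h5 : Real.exp (-(x - m) ^ 2 / (2 * s)) ^ 2 = Real.exp (m ^ 2 / (2 - s)) *
        Real.exp (-(x - 2 * m / (2 - s)) ^ 2 / (2 * (s / (2 - s)))) *
        Real.exp (-(x - 0) ^ 2 / (2 * (1 : ℝ≥0))) := by
      rw [← Real.exp_nat_mul, ← Real.exp_add, ← Real.exp_add]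
      congr 1
      push_cast
      field_simp
      ring
    rw [mul_pow, h5]
    field_simp
    simp
  simp_rw [key]
  rw [lintegral_const_mul _ (measurable_gaussianPDF _ _), lintegral_gaussianPDF_eq_one _ hv,
    mul_one]

/-- Boxes determine a product measure; on a box the integrand is a product of functions of single
coordinates, and these are independent. -/
lemma pi_withDensity_prod (μ : κ → Measure ℝ) [∀ j, IsProbabilityMeasure (μ j)]
    (ρ : κ → ℝ → ℝ≥0∞) (hρ : ∀ j, Measurable (ρ j))
    [∀ j, IsProbabilityMeasure ((μ j).withDensity (ρ j))] :
    (Measure.pi μ).withDensity (fun x => ∏ j, ρ j (x j))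
      = Measure.pi fun j => (μ j).withDensity (ρ j) := by
  refine (Measure.pi_eq fun A hA => ?_).symm
  rw [withDensity_apply _ (.univ_pi hA), ← lintegral_indicator (.univ_pi hA)]
  have hind : iIndepFun (fun j (x : κ → ℝ) => (A j).indicator (ρ j) (x j)) (Measure.pi μ) :=
    iIndepFun_pi (X := fun j => (A j).indicator (ρ j))
      fun j => ((hρ j).indicator (hA j)).aemeasurable
  have h := lintegral_prod_eq_prod_lintegral_of_indepFun Finset.univ _ hind
    fun j => ((hρ j).indicator (hA j)).comp (measurable_pi_apply j)
  have e : ∀ x : κ → ℝ, (Set.univ.pi A).indicator (fun x => ∏ j, ρ j (x j)) x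
      = ∏ j, (A j).indicator (ρ j) (x j) := fun x => by
    by_cases hx : x ∈ Set.univ.pi A
    · rw [Set.indicator_of_mem hx]
      exact Finset.prod_congr rfl fun j _ => (Set.indicator_of_mem (hx j trivial) _).symm
    · rw [Set.indicator_of_notMem hx]
      simp only [Set.mem_univ_pi, not_forall] at hx
      obtain ⟨j, hj⟩ := hx
      exact (Finset.prod_eq_zero (Finset.mem_univ j) (Set.indicator_of_notMem hj _)).symm
  simp_rw [e, h]
  refine Finset.prod_congr rfl fun j _ => ?_
  rw [withDensity_apply _ (hA j), ← lintegral_indicator (hA j)]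
  exact (measurePreserving_eval μ j).lintegral_comp ((hρ j).indicator (hA j))

/-- Change of measure between a product of Gaussian laws and the standard normal law. -/
lemma lintegral_pi_gaussianReal_le (m : κ → ℝ) (s : κ → ℝ≥0) (hs : ∀ j, s j ≠ 0)
    (hs2 : ∀ j, (s j : ℝ) < 2) (G : (κ → ℝ) → ℝ≥0∞) (hG : Measurable G) :
    ∫⁻ x, G x ∂(Measure.pi fun j => gaussianReal (m j) (s j))
      ≤ ∫⁻ x, G x ^ 2 ∂(Measure.pi fun _ : κ => gaussianReal 0 1)
        + ∏ j, ENNReal.ofReal (Real.exp (m j ^ 2 / (2 - s j)) / Real.sqrt (s j * (2 - s j))) := by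
  have hI : ∀ j, IsProbabilityMeasure ((gaussianReal 0 1).withDensity (gaussianRatio (m j) (s j))) :=
    fun j => by rw [withDensity_gaussianRatio _ (hs j)]; infer_instance
  have hmeas : ∀ j, Measurable (gaussianRatio (m j) (s j)) := fun j => measurable_gaussianRatio _ _
  have hprod : Measurable fun x : κ → ℝ => ∏ j, gaussianRatio (m j) (s j) (x j) :=
    Finset.measurable_prod _ fun j _ => (hmeas j).comp (measurable_pi_apply j)
  have e := pi_withDensity_prod (fun _ : κ => gaussianReal 0 1)
    (fun j => gaussianRatio (m j) (s j)) hmeas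
  simp_rw [withDensity_gaussianRatio _ (hs _)] at e
  rw [← e, lintegral_withDensity_eq_lintegral_mul _ hprod hG]
  have hind : iIndepFun (fun (j : κ) (x : κ → ℝ) => gaussianRatio (m j) (s j) (x j) ^ 2)
      (Measure.pi fun _ : κ => gaussianReal 0 1) :=
    iIndepFun_pi (X := fun j (x : ℝ) => gaussianRatio (m j) (s j) x ^ 2)
      fun j => ((hmeas j).pow_const 2).aemeasurable
  have h := lintegral_prod_eq_prod_lintegral_of_indepFun Finset.univ _ hind
    fun j => ((hmeas j).pow_const 2).comp (measurable_pi_apply j)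
  calc ∫⁻ x, ((fun x : κ → ℝ => ∏ j, gaussianRatio (m j) (s j) (x j)) * G) x
        ∂(Measure.pi fun _ : κ => gaussianReal 0 1)
      ≤ ∫⁻ x, (G x ^ 2 + ∏ j, gaussianRatio (m j) (s j) (x j) ^ 2)
        ∂(Measure.pi fun _ : κ => gaussianReal 0 1) := by
        refine lintegral_mono fun x => ?_
        rw [Finset.prod_pow, Pi.mul_apply]
        -- With `ρ` the likelihood ratio, `ρ G ≤ G² + ρ²` follows by comparing the two factors.
        rcases le_total (∏ j, gaussianRatio (m j) (s j) (x j)) (G x) with hle | hle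
        · exact (mul_le_mul_left hle _).trans (by rw [sq (G x)]; exact le_self_add)
        · exact (mul_le_mul_right hle _).trans (by rw [sq (∏ j, _)]; exact le_add_self)
    _ = _ := by
        rw [lintegral_add_left (hG.pow_const 2)]
        refine congrArg _ (h.trans ?_)
        refine Finset.prod_congr rfl fun j _ => ?_
        rw [← lintegral_gaussianRatio_sq (m j) (hs j) (hs2 j)]
        exact (measurePreserving_eval (fun _ : κ => gaussianReal 0 1) j).lintegral_comp
          ((hmeas j).pow_const 2)

end GaussianProducts

/-! ### Diagonalising a form on a subspace -/

section Diagonalisation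

variable {E : Type*} [NormedAddCommGroup E] [InnerProductSpace ℝ E] [FiniteDimensional ℝ E]

/-- A symmetric bilinear form is diagonal in some orthonormal basis of a given subspace. -/
lemma exists_orthonormalBasis_diagonal (V : Submodule ℝ E) (D : E →ₗ[ℝ] E) (hD : D.IsSymmetric) :
    ∃ (N : ℕ) (b : OrthonormalBasis (Fin N) ℝ V), N = Module.finrank ℝ V ∧
      ∀ j j', j ≠ j' → inner ℝ (D (b j : E)) (b j' : E) = 0 := by
  -- The compression of `D` to `V` represents the same form on `V`; its orthonormal eigenbasis
  -- diagonalises it.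
  let T : V →ₗ[ℝ] V := V.orthogonalProjectionOnto.toLinearMap ∘ₗ D ∘ₗ V.subtype
  have hTin : ∀ v w : V, inner ℝ (T v) w = inner ℝ (D (v : E)) (w : E) := fun v w => by
    simp [T]
  have hT : T.IsSymmetric := fun v w => by
    rw [hTin, real_inner_comm (T w), hTin, real_inner_comm, hD]
  refine ⟨_, hT.eigenvectorBasis rfl, rfl, fun j j' hj => ?_⟩
  rw [← hTin, hT.apply_eigenvectorBasis, inner_smul_left,
    (hT.eigenvectorBasis rfl).inner_eq_zero hj, mul_zero]

end Diagonalisation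

/-! ### Change of measure for functionals of few linear statistics -/

section Comparison

variable {ι κ : Type*} [Fintype ι] [Fintype κ]

/-- Comparison of expectations under two products of Gaussian laws for a functional that depends
only on `card κ` linear functionals of the observations. -/
lemma lintegral_pi_gaussianReal_le_of_linear (v : κ → ι → ℝ) (A : Finset ι)
    (hvA : ∀ c, ∀ i ∉ A, v c i = 0) (g : ι → ℝ) (s s₀ : ι → ℝ≥0) (δ : ℝ) (hδ0 : 0 ≤ δ) (hδ1 : δ < 1)
    (hs : ∀ i, s i ≠ 0) (hlo : ∀ i, 1 - δ ≤ (s₀ i : ℝ) / s i) (hhi : ∀ i, (s₀ i : ℝ) / s i ≤ 1 + δ)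
    (G : (ι → ℝ) → ℝ≥0∞) (hG : Measurable G)
    (hGv : ∀ y y', (∀ c, ∑ i, v c i * y i = ∑ i, v c i * y' i) → G y = G y') :
    ∫⁻ y, G y ∂(Measure.pi fun i => gaussianReal (g i) (s₀ i))
      ≤ ∫⁻ y, G y ^ 2 ∂(Measure.pi fun i => gaussianReal 0 (s i))
        + ENNReal.ofReal (Real.exp ((∑ i ∈ A, g i ^ 2 / s i) / (1 - δ))
            * (1 / Real.sqrt (1 - δ ^ 2)) ^ Fintype.card κ) := by
  classical
  have hsp : ∀ i, (0 : ℝ) < s i := fun i => by have := hs i; positivity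
  set q : ι → ℝ := fun i => Real.sqrt (s i) with hq
  have hqp : ∀ i, 0 < q i := fun i => Real.sqrt_pos.2 (hsp i)
  have hqq : ∀ i, q i * q i = s i := fun i => Real.mul_self_sqrt (hsp i).le
  -- In the coordinates `y i / q i` the reference law has identity covariance and the other law has
  -- covariance `D`. A basis of `V` that is orthonormal and diagonal for `D` therefore makes the new
  -- coordinates independent under both laws.
  let vt : κ → EuclideanSpace ℝ ι := fun c => WithLp.toLp 2 fun i => v c i * q i
  let V := Submodule.span ℝ (Set.range vt)
  let D : EuclideanSpace ℝ ι →ₗ[ℝ] EuclideanSpace ℝ ι :=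
    { toFun := fun z => WithLp.toLp 2 fun i => (s₀ i : ℝ) / s i * z i
      map_add' := fun z z' => by ext i; simp [mul_add]
      map_smul' := fun c z => by ext i; simp; ring }
  have inner_eq : ∀ z z' : EuclideanSpace ℝ ι, inner ℝ z z' = ∑ i, z i * z' i := fun z z' => by
    simp [PiLp.inner_apply, mul_comm]
  have hD : D.IsSymmetric := fun z z' => by
    rw [inner_eq, inner_eq]
    exact Finset.sum_congr rfl fun i _ => by simp only [D, LinearMap.coe_mk, AddHom.coe_mk]; ring
  obtain ⟨N, b, hN, hb⟩ := exists_orthonormalBasis_diagonal V D hD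
  have hNle : N ≤ Fintype.card κ := hN ▸ finrank_range_le_card vt
  have hbo : ∀ j j', ∑ i, (b j : EuclideanSpace ℝ ι) i * (b j' : EuclideanSpace ℝ ι) i
      = if j = j' then 1 else 0 := fun j j' => by
    rw [← inner_eq, ← Submodule.coe_inner, orthonormal_iff_ite.1 b.orthonormal]
  let lam : Fin N → ℝ := fun j =>
    ∑ i, (s₀ i : ℝ) / s i * ((b j : EuclideanSpace ℝ ι) i * (b j : EuclideanSpace ℝ ι) i)
  have hlamlo : ∀ j, 1 - δ ≤ lam j := fun j => by
    have h1 : (1 - δ) * ∑ i, (b j : EuclideanSpace ℝ ι) i * (b j : EuclideanSpace ℝ ι) i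
        ≤ lam j := by
      rw [Finset.mul_sum]
      exact Finset.sum_le_sum fun i _ => mul_le_mul_of_nonneg_right (hlo i) (mul_self_nonneg _)
    simpa [hbo] using h1
  have hlamhi : ∀ j, lam j ≤ 1 + δ := fun j => by
    have h1 : lam j ≤ (1 + δ) * ∑ i, (b j : EuclideanSpace ℝ ι) i
        * (b j : EuclideanSpace ℝ ι) i := by
      rw [Finset.mul_sum]
      exact Finset.sum_le_sum fun i _ => mul_le_mul_of_nonneg_right (hhi i) (mul_self_nonneg _)
    simpa [hbo] using h1
  have hlamp : ∀ j, 0 < lam j := fun j => by linarith [hlamlo j]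
  let a : Fin N → ι → ℝ := fun j i => (b j : EuclideanSpace ℝ ι) i / q i
  have ha : ∀ j j', ∑ i, a j i * a j' i * s i = if j = j' then ((1 : ℝ≥0) : ℝ) else 0 :=
    fun j j' => by
      rw [NNReal.coe_one, ← hbo]
      refine Finset.sum_congr rfl fun i _ => ?_
      have := (hqp i).ne'
      simp only [a, ← hqq]
      field_simp
  have ha₀ : ∀ j j', ∑ i, a j i * a j' i * s₀ i
      = if j = j' then ((lam j).toNNReal : ℝ) else 0 := fun j j' => by
    have h1 : ∑ i, a j i * a j' i * s₀ i = ∑ i, (s₀ i : ℝ) / s i *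
        ((b j : EuclideanSpace ℝ ι) i * (b j' : EuclideanSpace ℝ ι) i) := by
      refine Finset.sum_congr rfl fun i _ => ?_
      have := (hqp i).ne'
      simp only [a, ← hqq]
      field_simp
    rw [h1]
    split_ifs with hj
    · rw [Real.coe_toNNReal _ (hlamp j).le, ← hj]
    · rw [← hb j j' hj, inner_eq]
      exact Finset.sum_congr rfl fun i _ => by simp only [D, LinearMap.coe_mk, AddHom.coe_mk]; ring
  let x : (ι → ℝ) → Fin N → ℝ := fun y j => ∑ i, a j i * y i
  have hx : Measurable x := by fun_prop
  -- `P` rebuilds from the coordinates the part of the observation lying in `V`. The functionals `v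
  -- c` see nothing else, so `G` factors through `x`.
  let P : (Fin N → ℝ) → ι → ℝ := fun ξ i => ∑ j, ξ j * ((b j : EuclideanSpace ℝ ι) i * q i)
  have hP : Measurable P := by fun_prop
  have hmemV : ∀ c, vt c ∈ V := fun c => Submodule.subset_span ⟨c, rfl⟩
  have hGP : ∀ y, G y = G (P (x y)) := fun y => by
    refine hGv _ _ fun c => ?_
    have h1 := congrArg (Subtype.val) (b.sum_repr' ⟨vt c, hmemV c⟩)
    have h2 : ∀ i, v c i * q i = ∑ j, (∑ i', (b j : EuclideanSpace ℝ ι) i' * (v c i' * q i'))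
        * (b j : EuclideanSpace ℝ ι) i := fun i => by
      have h3 := congrArg (fun z : EuclideanSpace ℝ ι => z i) h1
      simp only [Submodule.coe_sum, Submodule.coe_smul, Submodule.coe_inner, inner_eq] at h3
      simpa [vt] using h3.symm
    calc ∑ i, v c i * y i = ∑ i, (v c i * q i) * (y i / q i) :=
          Finset.sum_congr rfl fun i _ => by have := (hqp i).ne'; field_simp
      _ = ∑ i, ∑ j, (∑ i', (b j : EuclideanSpace ℝ ι) i' * (v c i' * q i'))
            * ((b j : EuclideanSpace ℝ ι) i / q i * y i) := by
          refine Finset.sum_congr rfl fun i _ => ?_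
          rw [h2 i, Finset.sum_mul]
          exact Finset.sum_congr rfl fun j _ => by ring
      _ = ∑ j, (∑ i', (b j : EuclideanSpace ℝ ι) i' * (v c i' * q i')) * x y j := by
          rw [Finset.sum_comm]
          exact Finset.sum_congr rfl fun j _ => by rw [← Finset.mul_sum]
      _ = ∑ i, v c i * P (x y) i := by
          simp only [P, Finset.mul_sum, Finset.sum_mul]
          rw [Finset.sum_comm]
          exact Finset.sum_congr rfl fun i _ => Finset.sum_congr rfl fun j _ => by ring
  have e1 := map_pi_gaussianReal_of_orthogonal a g s₀ (fun j => (lam j).toNNReal) ha₀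
  have e2 := map_pi_gaussianReal_of_orthogonal a (fun _ => 0) s (fun _ => 1) ha
  simp only [mul_zero, Finset.sum_const_zero] at e2
  have hF : Measurable fun ξ => G (P ξ) := hG.comp hP
  have e3 : ∫⁻ y, G y ∂(Measure.pi fun i => gaussianReal (g i) (s₀ i))
      = ∫⁻ ξ, G (P ξ) ∂(Measure.pi fun j => gaussianReal (∑ i, a j i * g i) (lam j).toNNReal) := by
    rw [← e1, lintegral_map hF hx]
    exact lintegral_congr hGP
  have e4 : ∫⁻ y, G y ^ 2 ∂(Measure.pi fun i => gaussianReal 0 (s i))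
      = ∫⁻ ξ, G (P ξ) ^ 2 ∂(Measure.pi fun _ : Fin N => gaussianReal 0 1) := by
    rw [← e2, lintegral_map (hF.pow_const 2) hx]
    exact lintegral_congr fun y => by rw [hGP y]
  rw [e3, e4]
  refine (lintegral_pi_gaussianReal_le _ _ (fun j => by simpa using hlamp j) (fun j => by
    rw [Real.coe_toNNReal _ (hlamp j).le]; linarith [hlamhi j]) _ hF).trans ?_
  gcongr
  simp only [Real.coe_toNNReal _ (hlamp _).le]
  rw [← ENNReal.ofReal_prod_of_nonneg fun _ _ => by positivity]
  refine ENNReal.ofReal_le_ofReal ?_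
  have hδ2 : 0 < 1 - δ ^ 2 := by nlinarith
  have hsd : 0 < Real.sqrt (1 - δ ^ 2) := Real.sqrt_pos.2 hδ2
  have hsd1 : Real.sqrt (1 - δ ^ 2) ≤ 1 := Real.sqrt_le_one.2 (by nlinarith)
  -- The new means are inner products of `g / q` with orthonormal vectors supported in `A`, so
  -- Bessel's inequality applies to the restriction of `g / q` to `A`.
  have hBessel : ∑ j, (∑ i, a j i * g i) ^ 2 ≤ ∑ i ∈ A, g i ^ 2 / s i := by
    let gA : EuclideanSpace ℝ ι := WithLp.toLp 2 fun i => if i ∈ A then g i / q i else 0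
    have hbA : ∀ j, ∀ i ∉ A, (b j : EuclideanSpace ℝ ι) i = 0 := fun j i hi => by
      have : V ≤ LinearMap.ker (EuclideanSpace.proj (𝕜 := ℝ) i : EuclideanSpace ℝ ι →L[ℝ] ℝ).toLinearMap := by
        refine Submodule.span_le.2 ?_
        rintro _ ⟨c, rfl⟩
        simp [vt, hvA c i hi]
      simpa using this (b j).2
    have hon : Orthonormal ℝ fun j => (b j : EuclideanSpace ℝ ι) :=
      b.orthonormal.comp_linearIsometry V.subtypeₗᵢ
    have h1 := hon.sum_inner_products_le gA (s := Finset.univ)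
    have h2 : ‖gA‖ ^ 2 = ∑ i ∈ A, g i ^ 2 / s i := by
      rw [← real_inner_self_eq_norm_sq, inner_eq, ← Finset.sum_subset (Finset.subset_univ A)]
      · refine Finset.sum_congr rfl fun i hi => ?_
        have := (hqp i).ne'
        simp only [gA, if_pos hi, ← hqq]
        field_simp
      · intro i _ hi
        simp [gA, hi]
    rw [h2] at h1
    refine le_trans (le_of_eq (Finset.sum_congr rfl fun j _ => ?_)) h1
    rw [inner_eq, Real.norm_eq_abs, sq_abs]
    congr 1
    refine Finset.sum_congr rfl fun i _ => ?_
    by_cases hi : i ∈ A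
    · simp only [a, gA, if_pos hi]; ring
    · simp [a, hbA j i hi]
  calc ∏ j, Real.exp ((∑ i, a j i * g i) ^ 2 / (2 - lam j)) / Real.sqrt (lam j * (2 - lam j))
      ≤ ∏ j, Real.exp ((∑ i, a j i * g i) ^ 2 / (1 - δ)) * (1 / Real.sqrt (1 - δ ^ 2)) := by
        -- With `|lam j - 1| ≤ δ`: `2 - lam j ≥ 1 - δ` and `lam j (2 - lam j) = 1 - (lam j - 1)² ≥ 1
        -- - δ²`.
        refine Finset.prod_le_prod (fun j _ => by positivity) fun j _ => ?_
        rw [div_eq_mul_one_div]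
        have := hlamhi j
        have := hlamlo j
        refine mul_le_mul (Real.exp_le_exp.2 ?_) (one_div_le_one_div_of_le hsd
          (Real.sqrt_le_sqrt (by nlinarith))) (by positivity) (by positivity)
        exact div_le_div_of_nonneg_left (sq_nonneg _) (by linarith) (by linarith)
    _ = Real.exp ((∑ j, (∑ i, a j i * g i) ^ 2) / (1 - δ)) * (1 / Real.sqrt (1 - δ ^ 2)) ^ N := by
        rw [Finset.prod_mul_distrib, ← Real.exp_sum, Finset.sum_div]
        simp
    _ ≤ _ := by
        have : 0 < 1 - δ := by linarith
        have h1 : 1 ≤ 1 / Real.sqrt (1 - δ ^ 2) := by rw [le_div_iff₀ hsd]; linarith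
        gcongr

end Comparison

namespace LocPoly.Scheme

variable {n : ℕ} (S : Scheme n) (ℓ : ℕ) (x : ℝ)

/-! ### Normal equations and polynomial reproduction -/

section Algebra

lemma dotProduct_B_mulVec (k : ℕ) (d d' : Fin (ℓ + 1) → ℝ) :
    d ⬝ᵥ (S.B ℓ x k *ᵥ d') = ∑ i, ((S.Psi ℓ x)ᵀ *ᵥ d) i * ((S.Psi ℓ x)ᵀ *ᵥ d') i
      * (S.w k i / (S.varModel i : ℝ)) := by
  rw [B, ← Matrix.mulVec_mulVec, ← Matrix.mulVec_mulVec, Matrix.dotProduct_mulVec,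
    ← Matrix.mulVec_transpose, dotProduct]
  refine Finset.sum_congr rfl fun i _ => ?_
  rw [W, Matrix.mulVec_diagonal]
  ring

lemma dotProduct_Psi_W_mulVec (k : ℕ) (d : Fin (ℓ + 1) → ℝ) (y : Fin n → ℝ) :
    d ⬝ᵥ ((S.Psi ℓ x * S.W k) *ᵥ y) = ∑ i, ((S.Psi ℓ x)ᵀ *ᵥ d) i * y i
      * (S.w k i / (S.varModel i : ℝ)) := by
  rw [← Matrix.mulVec_mulVec, Matrix.dotProduct_mulVec, ← Matrix.mulVec_transpose, dotProduct]
  refine Finset.sum_congr rfl fun i _ => ?_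
  rw [W, Matrix.mulVec_diagonal]
  ring

lemma Psi_W_mulVec_apply (k : ℕ) (y : Fin n → ℝ) (c : Fin (ℓ + 1)) :
    ((S.Psi ℓ x * S.W k) *ᵥ y) c = ∑ i, S.Psi ℓ x c i * (S.w k i / (S.varModel i : ℝ)) * y i := by
  simp [Matrix.mulVec, dotProduct, W, Matrix.mul_diagonal]

variable {S ℓ x}

lemma B_mulVec_qmle {k : ℕ} (hk : IsUnit (S.B ℓ x k).det) (y : Fin n → ℝ) :
    S.B ℓ x k *ᵥ S.qmle ℓ x k y = (S.Psi ℓ x * S.W k) *ᵥ y := by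
  rw [qmle, Matrix.mulVec_mulVec, Matrix.mul_nonsing_inv _ hk, Matrix.one_mulVec]

/-- The fitted log-likelihood is a quadratic form in the difference of the estimators. -/
lemma T_eq {l : ℕ} (hl : IsUnit (S.B ℓ x l).det) (m : ℕ) (y : Fin n → ℝ) :
    S.T ℓ x l m y = (S.qmle ℓ x l y - S.qmle ℓ x m y) ⬝ᵥ
      (S.B ℓ x l *ᵥ (S.qmle ℓ x l y - S.qmle ℓ x m y)) := by
  -- The normal equations tested against the difference of the estimators; the claimed identity is
  -- `-2` times this one.
  have h1 := congrArg (fun v => (S.qmle ℓ x l y - S.qmle ℓ x m y) ⬝ᵥ v) (B_mulVec_qmle hl y)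
  simp only [dotProduct_B_mulVec, dotProduct_Psi_W_mulVec] at h1
  rw [T, logLik, logLik, dotProduct_B_mulVec]
  generalize S.qmle ℓ x l y = a at h1 ⊢
  generalize S.qmle ℓ x m y = b at h1 ⊢
  rw [← sub_eq_zero, ← Finset.sum_sub_distrib] at h1
  rw [← sub_eq_zero, ← mul_sub, ← Finset.sum_sub_distrib, Finset.mul_sum, Finset.mul_sum,
    ← Finset.sum_sub_distrib]
  have h2 := congrArg (fun t => -2 * t) h1
  simp only [mul_zero, Finset.mul_sum] at h2
  rw [← h2]
  refine Finset.sum_congr rfl fun i _ => ?_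
  simp only [Matrix.mulVec_sub, Pi.sub_apply]
  ring

/-- Since `B_k = Ψ W_k Ψᵀ`, polynomials are reproduced exactly. A polynomial trend thus shifts all
scales equally and cancels in every test. -/
lemma qmle_add_mulVec {k : ℕ} (hk : IsUnit (S.B ℓ x k).det) (y : Fin n → ℝ)
    (θ : Fin (ℓ + 1) → ℝ) :
    S.qmle ℓ x k (y + (S.Psi ℓ x)ᵀ *ᵥ θ) = S.qmle ℓ x k y + θ := by
  have h : (S.Psi ℓ x * S.W k) *ᵥ ((S.Psi ℓ x)ᵀ *ᵥ θ) = S.B ℓ x k *ᵥ θ := by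
    rw [Matrix.mulVec_mulVec, B]
  rw [qmle, Matrix.mulVec_add, Matrix.mulVec_add, h, Matrix.mulVec_mulVec θ,
    Matrix.nonsing_inv_mul _ hk, Matrix.one_mulVec, qmle]

end Algebra

/-! ### Lepski's selection rule -/

section Selection

variable {S ℓ x}

lemma khat_mem (hK : 1 ≤ S.K) (y : Fin n → ℝ) :
    1 ≤ S.khat ℓ x y ∧ S.khat ℓ x y ≤ S.K ∧
      ∀ l m, 1 ≤ l → l < m → m ≤ S.khat ℓ x y → S.T ℓ x l m y ≤ S.z l :=
  Nat.sSup_mem (s := {k | 1 ≤ k ∧ k ≤ S.K ∧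
      ∀ l m, 1 ≤ l → l < m → m ≤ k → S.T ℓ x l m y ≤ S.z l})
    ⟨1, le_rfl, hK, fun _ _ _ _ _ => by omega⟩ ⟨S.K, fun _ hk => hk.2.1⟩

/-- Acceptance is inherited by smaller scales, so reaching `j` is a condition on the tests up to `j`
alone. Locality and measurability of the rule rest on this. -/
lemma le_khat_iff (hK : 1 ≤ S.K) (y : Fin n → ℝ) {j : ℕ} (hj : 1 ≤ j) (hjK : j ≤ S.K) :
    j ≤ S.khat ℓ x y ↔ ∀ l m, 1 ≤ l → l < m → m ≤ j → S.T ℓ x l m y ≤ S.z l :=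
  ⟨fun h l m hl hlm hm => (khat_mem hK y).2.2 l m hl hlm (hm.trans h),
    fun h => le_csSup ⟨S.K, fun _ hk => hk.2.1⟩ ⟨hj, hjK, h⟩⟩

lemma min_khat_congr (hK : 1 ≤ S.K) {k : ℕ} (hkK : k ≤ S.K) {y y' : Fin n → ℝ}
    (h : ∀ l m, 1 ≤ l → l < m → m ≤ k → S.T ℓ x l m y = S.T ℓ x l m y') :
    min k (S.khat ℓ x y) = min k (S.khat ℓ x y') := by
  have key : ∀ j, 1 ≤ j → j ≤ k → (j ≤ S.khat ℓ x y ↔ j ≤ S.khat ℓ x y') := fun j hj hjk => by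
    rw [le_khat_iff hK y hj (hjk.trans hkK), le_khat_iff hK y' hj (hjk.trans hkK)]
    exact forall₂_congr fun l m => forall₃_congr fun hl hlm hm => by rw [h l m hl hlm (hm.trans hjk)]
  refine le_antisymm ?_ ?_
  · rcases Nat.eq_zero_or_pos (min k (S.khat ℓ x y)) with h0 | h0
    · omega
    · exact le_min (min_le_left _ _) ((key _ h0 (min_le_left _ _)).1 (min_le_right _ _))
  · rcases Nat.eq_zero_or_pos (min k (S.khat ℓ x y')) with h0 | h0
    · omega
    · exact le_min (min_le_left _ _) ((key _ h0 (min_le_left _ _)).2 (min_le_right _ _))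

/-- The difference between the estimator at scale `k` and the last accepted one only depends on
the scales up to `k`, and is not affected by a polynomial trend. -/
lemma qmle_sub_lastAccepted_congr (hK : 1 ≤ S.K) {k : ℕ} (hk : 1 ≤ k) (hkK : k ≤ S.K)
    (hB : ∀ l, 1 ≤ l → l ≤ k → IsUnit (S.B ℓ x l).det) {y y' : Fin n → ℝ} (θ : Fin (ℓ + 1) → ℝ)
    (h : ∀ l, 1 ≤ l → l ≤ k → S.qmle ℓ x l y = S.qmle ℓ x l y' + θ) :
    S.qmle ℓ x k y - S.lastAccepted ℓ x k y = S.qmle ℓ x k y' - S.lastAccepted ℓ x k y' := by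
  have hmin : min k (S.khat ℓ x y) = min k (S.khat ℓ x y') :=
    min_khat_congr hK hkK fun l m hl hlm hm => by
      rw [T_eq (hB l hl (by omega)), T_eq (hB l hl (by omega)), h l hl (by omega),
        h m (by omega) hm, add_sub_add_right_eq_sub]
  have h1 := (khat_mem (ℓ := ℓ) (x := x) hK y').1
  rw [lastAccepted, lastAccepted, hmin, h k hk le_rfl, h _ (le_min hk h1) (min_le_left _ _),
    add_sub_add_right_eq_sub]

end Selection

/-! ### Measurability of the selected estimators -/

section Measurability

@[fun_prop]
lemma measurable_qmle (k : ℕ) : Measurable (S.qmle ℓ x k) :=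
  (continuous_const.matrix_mulVec (continuous_const.matrix_mulVec continuous_id)).measurable

@[fun_prop]
lemma measurable_qmle_apply (k : ℕ) (j : Fin (ℓ + 1)) : Measurable fun y => S.qmle ℓ x k y j :=
  (measurable_pi_apply j).comp (S.measurable_qmle ℓ x k)

@[fun_prop]
lemma measurable_logLik (k m : ℕ) : Measurable fun y => S.logLik ℓ x k (S.qmle ℓ x m y) y := by
  have h : ∀ i, Measurable fun y => ((S.Psi ℓ x)ᵀ *ᵥ S.qmle ℓ x m y) i := fun i =>
    (measurable_pi_apply i).comp ((continuous_const.matrix_mulVec continuous_id).measurable.comp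
      (S.measurable_qmle ℓ x m))
  unfold logLik
  fun_prop

lemma measurable_T (l m : ℕ) : Measurable (S.T ℓ x l m) :=
  ((S.measurable_logLik ℓ x l l).sub (S.measurable_logLik ℓ x l m)).const_mul 2

lemma measurable_khat (hK : 1 ≤ S.K) : Measurable (S.khat ℓ x) := by
  refine measurable_of_Ici fun j => ?_
  by_cases hj : 1 ≤ j
  · by_cases hjK : j ≤ S.K
    · have : S.khat ℓ x ⁻¹' Set.Ici j = ⋂ l, ⋂ m, ⋂ (_ : 1 ≤ l), ⋂ (_ : l < m), ⋂ (_ : m ≤ j),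
          {y | S.T ℓ x l m y ≤ S.z l} := by
        ext y
        simp only [Set.mem_preimage, Set.mem_Ici, Set.mem_iInter, Set.mem_ofPred_eq]
        exact le_khat_iff hK y hj hjK
      rw [this]
      exact .iInter fun l => .iInter fun m => .iInter fun _ => .iInter fun _ => .iInter fun _ =>
        measurableSet_le (S.measurable_T ℓ x l m) measurable_const
    · have : S.khat ℓ x ⁻¹' Set.Ici j = ∅ := by
        ext y
        have := (khat_mem (ℓ := ℓ) (x := x) hK y).2.1
        simp only [Set.mem_preimage, Set.mem_Ici, Set.mem_empty_iff_false, iff_false]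
        omega
      rw [this]
      exact .empty
  · have : S.khat ℓ x ⁻¹' Set.Ici j = Set.univ := by
      ext y
      simp only [Set.mem_preimage, Set.mem_Ici, Set.mem_univ, iff_true]
      omega
    rw [this]
    exact .univ

lemma measurable_lastAccepted (hK : 1 ≤ S.K) (k : ℕ) : Measurable (S.lastAccepted ℓ x k) := by
  have h : Measurable fun p : ℕ × (Fin n → ℝ) => S.qmle ℓ x (min k p.1) p.2 :=
    measurable_from_prod_countable_right fun j => S.measurable_qmle ℓ x (min k j)
  have h2 : Measurable fun y => (S.khat ℓ x y, y) :=
    (S.measurable_khat ℓ x hK).prodMk measurable_id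
  have h3 := h.comp h2
  simp only [Function.comp_def] at h3
  unfold lastAccepted
  exact h3

end Measurability

end LocPoly.Scheme

/-! ### Taylor expansion in the Hölder class -/

namespace LocPoly

/-- Taylor expansion in a Hölder class: abstract form for a chain of derivatives. -/
lemma taylor_chain {s : Set ℝ} (hs : Convex ℝ s) {x : ℝ} (hx : x ∈ s) (L : ℝ) (hL : 0 ≤ L) :
    ∀ (ℓ : ℕ) (F : ℕ → ℝ → ℝ) (γ : ℝ), 0 ≤ γ →
      (∀ j < ℓ, ∀ t ∈ s, HasDerivWithinAt (F j) (F (j + 1) t) s t) →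
      (∀ t ∈ s, |F ℓ t - F ℓ x| ≤ L * |t - x| ^ γ) →
      ∀ t ∈ s, |F 0 t - ∑ j ∈ Finset.range (ℓ + 1), (t - x) ^ j / (j ! : ℝ) * F j x|
        ≤ L * |t - x| ^ (γ + ℓ) := by
  intro ℓ
  induction ℓ with
  | zero => intro F γ hγ _ h t ht; simpa using h t ht
  | succ ℓ ih =>
    intro F γ hγ hF h t ht
    have hd := ih (fun j => F (j + 1)) γ hγ (fun j hj => hF (j + 1) (by omega)) h
    set R : ℝ → ℝ := fun t =>
      F 0 t - ∑ j ∈ Finset.range (ℓ + 1 + 1), (t - x) ^ j / (j ! : ℝ) * F j x with hR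
    have hRx : R x = 0 := by
      simp [hR, Finset.sum_range_succ']
    have hderiv : ∀ y ∈ s, HasDerivWithinAt R (F 1 y -
        ∑ j ∈ Finset.range (ℓ + 1), (y - x) ^ j / (j ! : ℝ) * F (j + 1) x) s y := by
      intro y hy
      refine (hF 0 (by omega) y hy).sub ?_
      have h1 : ∀ j : ℕ, HasDerivWithinAt (fun t => (t - x) ^ (j + 1) / ((j + 1)! : ℝ) * F (j + 1) x)
          ((y - x) ^ j / (j ! : ℝ) * F (j + 1) x) s y := fun j => by
        have h2 := ((((hasDerivAt_id y).sub_const x).pow (j + 1)).div_const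
          ((j + 1)! : ℝ)).mul_const (F (j + 1) x)
        refine h2.hasDerivWithinAt.congr_deriv ?_
        have : ((j + 1)! : ℝ) = (j + 1) * j ! := by push_cast [Nat.factorial_succ]; ring
        rw [this]
        have hj : (j ! : ℝ) ≠ 0 := by positivity
        have hj1 : (j + 1 : ℝ) ≠ 0 := by positivity
        simp only [id, Nat.cast_add, Nat.cast_one, Nat.add_sub_cancel, mul_one]
        field_simp
      have h3 : (fun t => ∑ j ∈ Finset.range (ℓ + 1 + 1), (t - x) ^ j / (j ! : ℝ) * F j x)
          = fun t => (∑ j ∈ Finset.range (ℓ + 1),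
            (t - x) ^ (j + 1) / ((j + 1)! : ℝ) * F (j + 1) x) + F 0 x := by
        ext t
        rw [Finset.sum_range_succ']
        simp
      rw [h3]
      exact (HasDerivWithinAt.fun_sum fun j _ => h1 j).add_const _
    have hseg : segment ℝ x t ⊆ s := hs.segment_subset hx ht
    -- The derivative of `R` is the remainder of the shifted chain, bounded by induction. On the
    -- segment `|y - x| ≤ |t - x|` makes that bound constant, and the mean value inequality gains
    -- one power.
    have hb := Convex.norm_image_sub_le_of_norm_hasDerivWithin_le (𝕜 := ℝ) (f := R) (s := segment ℝ x t)
      (C := L * |t - x| ^ (γ + ℓ)) (fun y hy => (hderiv y (hseg hy)).mono hseg) (fun y hy => by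
        refine (hd y (hseg hy)).trans ?_
        have : |y - x| ≤ |t - x| := by
          have := norm_sub_le_of_mem_segment hy
          rwa [Real.norm_eq_abs, Real.norm_eq_abs] at this
        gcongr) (convex_segment x t) (left_mem_segment ℝ x t) (right_mem_segment ℝ x t)
    rw [hRx, sub_zero, Real.norm_eq_abs, Real.norm_eq_abs] at hb
    refine hb.trans (le_of_eq ?_)
    rw [mul_assoc, Nat.cast_succ, ← add_assoc]
    congr 1
    by_cases h0 : t = x
    · rw [h0, sub_self, abs_zero, mul_zero, Real.zero_rpow (by positivity)]
    · rw [Real.rpow_add_one (abs_pos.2 (sub_ne_zero.2 h0)).ne']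

/-- The design functions carry the factors `1/j!`, so the coefficients are the derivatives at `x`
themselves. -/
lemma HolderClass.exists_taylor {ℓ : ℕ} {β L : ℝ} (hβ : (ℓ : ℝ) < β) (hL : 0 ≤ L) {f : ℝ → ℝ}
    (hf : f ∈ HolderClass ℓ β L) {x : ℝ} (hx : x ∈ Set.Icc (0 : ℝ) 1) :
    ∃ θ : Fin (ℓ + 1) → ℝ, θ 0 = f x ∧ ∀ t ∈ Set.Icc (0 : ℝ) 1,
      |f t - ∑ j : Fin (ℓ + 1), (t - x) ^ (j : ℕ) / ((j : ℕ)! : ℝ) * θ j| ≤ L * |t - x| ^ β := by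
  refine ⟨fun j => iteratedDerivWithin j f (Set.Icc 0 1) x, by simp, fun t ht => ?_⟩
  have h := taylor_chain (convex_Icc (0 : ℝ) 1) hx L hL ℓ
    (fun j => iteratedDerivWithin j f (Set.Icc 0 1)) (β - ℓ) (by linarith) (fun j hj t ht => by
      rw [iteratedDerivWithin_succ]
      exact (hf.1 j hj t ht).hasDerivWithinAt) (fun t ht => hf.2 t ht x hx) t ht
  rw [← Fin.sum_univ_eq_sum_range
    (fun j => (t - x) ^ j / (j ! : ℝ) * iteratedDerivWithin j f (Set.Icc 0 1) x)] at h
  simpa using h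

end LocPoly

/-- Gaussian absolute moments, uniformly over a range of means and variances. -/
lemma lintegral_abs_rpow_gaussianReal_le {r : ℝ} (hr : 0 < r) {c d : ℝ} (hc : 0 ≤ c) (hd : 0 ≤ d) :
    ∃ C : ℝ, 0 ≤ C ∧ ∀ (q m : ℝ) (v : ℝ≥0), 0 ≤ q → |m| ≤ c * q → Real.sqrt v ≤ d * q →
      ∫⁻ z, ENNReal.ofReal (|z| ^ r) ∂gaussianReal m v ≤ ENNReal.ofReal (C * q ^ r) := by
  -- For standard normal `Z`, `|√v Z + m| ≤ q (c + d |Z|)`; the constant is the `r`-th moment of `c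
  -- + d |Z|`.
  have hmem : MemLp (fun z : ℝ => c + d * |z|) (ENNReal.ofReal r) (gaussianReal 0 1) :=
    (memLp_const c).add
      ((memLp_id_gaussianReal' (ENNReal.ofReal r) ENNReal.ofReal_ne_top).norm.const_mul d)
  have hfin := lintegral_rpow_enorm_lt_top_of_eLpNorm_lt_top (by simpa using hr)
    ENNReal.ofReal_ne_top hmem.2
  rw [ENNReal.toReal_ofReal hr.le] at hfin
  refine ⟨_, ENNReal.toReal_nonneg (a := ∫⁻ z, ‖c + d * |z|‖ₑ ^ r ∂gaussianReal 0 1),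
    fun q m v hq hm hv => ?_⟩
  have e : gaussianReal m v = (gaussianReal 0 1).map fun z => Real.sqrt v * z + m := by
    have h1 : (fun z => Real.sqrt v * z + m) = (fun z => z + m) ∘ fun z => Real.sqrt v * z := rfl
    rw [h1, ← Measure.map_map (by fun_prop) (by fun_prop), gaussianReal_map_const_mul,
      gaussianReal_map_add_const]
    congr 1
    · ring
    · ext; simp
  rw [e, lintegral_map (by fun_prop) (by fun_prop), mul_comm,
    ENNReal.ofReal_mul (by positivity), ENNReal.ofReal_toReal hfin.ne,
    ← lintegral_const_mul _ (by fun_prop)]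
  refine lintegral_mono fun z => ?_
  have h0 : 0 ≤ c + d * |z| := by positivity
  rw [Real.enorm_of_nonneg h0, ENNReal.ofReal_rpow_of_nonneg h0 hr.le,
    ← ENNReal.ofReal_mul (by positivity), ← Real.mul_rpow hq h0]
  refine ENNReal.ofReal_le_ofReal (Real.rpow_le_rpow (abs_nonneg _) ?_ hr.le)
  calc |Real.sqrt v * z + m| ≤ Real.sqrt v * |z| + |m| := by
        refine (abs_add_le _ _).trans ?_
        rw [abs_mul, abs_of_nonneg (Real.sqrt_nonneg _)]
    _ ≤ d * q * |z| + c * q := by gcongr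
    _ = q * (c + d * |z|) := by ring

/-! ### Information, Taylor remainder and number of scales -/

namespace LocPoly.Scheme

variable {n : ℕ} {S : Scheme n} {ℓ : ℕ} {x : ℝ}

lemma CondBasic.h_ge (hS : S.CondBasic) {k : ℕ} (hk : k ∈ Finset.Icc 1 S.K) :
    1 / (2 * (n : ℝ)) ≤ S.h k := by
  rw [Finset.mem_Icc] at hk
  exact hS.2.2.2.1.trans (hS.2.2.2.2.2.monotoneOn ⟨le_rfl, hS.1⟩ ⟨hk.1, hk.2⟩ hk.1)

lemma CondBasic.h_pos (hS : S.CondBasic) (hn : 0 < n) {k : ℕ} (hk : k ∈ Finset.Icc 1 S.K) :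
    0 < S.h k :=
  lt_of_lt_of_le (by positivity) (hS.h_ge hk)

/-- The first diagonal entry of `H_k²` is `1` and the others are nonnegative; the first coordinate
is the one that estimates `f(x)`. -/
lemma CondLp1.le_quadForm {lam₀ vmax : ℝ} (h : S.CondLp1 ℓ x lam₀ vmax) (hS : S.CondBasic)
    (hn : 0 < n) (hlam : 0 < lam₀) (hv : 0 < vmax) {k : ℕ} (hk : k ∈ Finset.Icc 1 S.K)
    (d : Fin (ℓ + 1) → ℝ) :
    n * S.h k * lam₀ / vmax * d 0 ^ 2 ≤ d ⬝ᵥ (S.B ℓ x k *ᵥ d) := by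
  have hh := hS.h_pos hn hk
  have h1 := (h k hk).dotProduct_mulVec_nonneg d
  rw [Matrix.sub_mulVec, dotProduct_sub, Matrix.smul_mulVec, dotProduct_smul, star_trivial,
    smul_eq_mul, sub_nonneg] at h1
  refine le_trans ?_ h1
  gcongr
  rw [dotProduct]
  simp_rw [Matrix.mulVec_diagonal]
  refine le_trans (le_of_eq ?_) (Finset.single_le_sum (f := fun j : Fin (ℓ + 1) =>
    d j * ((S.h k ^ (j : ℕ)) ^ 2 * d j)) (fun j _ => ?_) (Finset.mem_univ 0))
  · simp [sq]
  · have : d j * ((S.h k ^ (j : ℕ)) ^ 2 * d j) = (S.h k ^ (j : ℕ) * d j) ^ 2 := by ring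
    rw [this]
    positivity

lemma CondLp1.isUnit_det {lam₀ vmax : ℝ} (h : S.CondLp1 ℓ x lam₀ vmax) (hS : S.CondBasic)
    (hn : 0 < n) (hlam : 0 < lam₀) (hv : 0 < vmax) {k : ℕ} (hk : k ∈ Finset.Icc 1 S.K) :
    IsUnit (S.B ℓ x k).det := by
  have hh := hS.h_pos hn hk
  have h1 : ((n * S.h k * lam₀ / vmax) •
      Matrix.diagonal fun j : Fin (ℓ + 1) => (S.h k ^ (j : ℕ)) ^ 2).PosDef := by
    rw [← Matrix.diagonal_smul]
    exact Matrix.PosDef.diagonal fun j => by simp only [Pi.smul_apply, smul_eq_mul]; positivity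
  have h2 := h1.posSemidef_add (h k hk)
  rw [sub_add_cancel] at h2
  exact (Matrix.isUnit_iff_isUnit_det _).1 h2.isUnit

/-- The weights are `0` or `1`, which makes the working covariance of the estimator exactly `B_k⁻¹`.
-/
lemma CondProd.sq_eq (h : S.CondProd) {k : ℕ} (hk : k ∈ Finset.Icc 1 S.K) (i : Fin n) :
    S.w k i * S.w k i = S.w k i :=
  h k k (Finset.mem_Icc.1 hk).1 le_rfl (Finset.mem_Icc.1 hk).2 i

/-- The first coordinate of the estimator is a linear functional of the observations, whose
variance is controlled by a lower bound on the information matrix. -/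
lemma exists_row {k : ℕ} (hdet : IsUnit (S.B ℓ x k).det) {κ : ℝ} (hκ : 0 < κ)
    (hquad : ∀ d : Fin (ℓ + 1) → ℝ, κ * d 0 ^ 2 ≤ d ⬝ᵥ (S.B ℓ x k *ᵥ d))
    (hw : ∀ i, S.w k i * S.w k i = S.w k i) (hv : ∀ i, (0 : ℝ) < S.varModel i) :
    ∃ a : Fin n → ℝ, (∀ y, S.qmle ℓ x k y 0 = ∑ i, a i * y i) ∧
      ∑ i, a i ^ 2 * S.varModel i ≤ 1 / κ ∧ ∀ i, S.w k i = 0 → a i = 0 := by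
  set q : Fin (ℓ + 1) → ℝ := fun c => (S.B ℓ x k)⁻¹ 0 c with hq
  refine ⟨fun i => ((S.Psi ℓ x)ᵀ *ᵥ q) i * (S.w k i / (S.varModel i : ℝ)), fun y => ?_, ?_,
    fun i hi => by simp [hi]⟩
  · have : S.qmle ℓ x k y 0 = q ⬝ᵥ ((S.Psi ℓ x * S.W k) *ᵥ y) := rfl
    rw [this, dotProduct_Psi_W_mulVec]
    exact Finset.sum_congr rfl fun i _ => by ring
  · have h1 : ∑ i, (((S.Psi ℓ x)ᵀ *ᵥ q) i * (S.w k i / (S.varModel i : ℝ))) ^ 2 * S.varModel i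
        = q ⬝ᵥ (S.B ℓ x k *ᵥ q) := by
      rw [dotProduct_B_mulVec]
      refine Finset.sum_congr rfl fun i _ => ?_
      have := (hv i).ne'
      field_simp
      rw [sq (S.w k i), hw i]
    have h2 : q ᵥ* S.B ℓ x k = Pi.single 0 1 := by
      have h3 : q = Pi.single 0 1 ᵥ* (S.B ℓ x k)⁻¹ := by
        rw [Matrix.single_one_vecMul]; rfl
      rw [h3, Matrix.vecMul_vecMul, Matrix.nonsing_inv_mul _ hdet, Matrix.vecMul_one]
    have h3 : q ⬝ᵥ (S.B ℓ x k *ᵥ q) = q 0 := by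
      rw [Matrix.dotProduct_mulVec, h2, single_one_dotProduct]
    -- `q` is the first row of `B_k⁻¹`, so `κ (q 0)² ≤ qᵀ B_k q = q 0`, whence the variance `q 0` is
    -- at most `1/κ`.
    have h4 := hquad q
    rw [h3] at h4
    rw [h1, h3, le_div_iff₀ hκ]
    by_contra hcon
    push Not at hcon
    have h5 : 0 < q 0 := by
      by_contra h6
      push Not at h6
      nlinarith
    nlinarith

lemma row_sum_sq_le {a g : Fin n → ℝ} {s : Fin n → ℝ} (hs : ∀ i, 0 < s i) (A : Finset (Fin n))
    (hA : ∀ i ∉ A, a i = 0) :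
    (∑ i, a i * g i) ^ 2 ≤ (∑ i, a i ^ 2 * s i) * ∑ i ∈ A, g i ^ 2 / s i := by
  have h1 : ∑ i, a i * g i = ∑ i ∈ A, (a i * Real.sqrt (s i)) * (g i / Real.sqrt (s i)) := by
    rw [← Finset.sum_subset (Finset.subset_univ A) fun i _ hi => by simp [hA i hi]]
    refine Finset.sum_congr rfl fun i _ => ?_
    have := (Real.sqrt_pos.2 (hs i)).ne'
    field_simp
  rw [h1]
  refine (Finset.sum_mul_sq_le_sq_mul_sq _ _ _).trans ?_
  have h2 : ∀ i, (a i * Real.sqrt (s i)) ^ 2 = a i ^ 2 * s i := fun i => by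
    rw [mul_pow, Real.sq_sqrt (hs i).le]
  have h3 : ∀ i, (g i / Real.sqrt (s i)) ^ 2 = g i ^ 2 / s i := fun i => by
    rw [div_pow, Real.sq_sqrt (hs i).le]
  simp_rw [h2, h3]
  refine mul_le_mul_of_nonneg_right (Finset.sum_le_univ_sum_of_nonneg fun i => ?_)
    (Finset.sum_nonneg fun i _ => by have := hs i; positivity)
  have := hs i
  positivity

/-- The design points with positive weight, and the size of the Taylor remainder on them. -/
lemma sum_remainder_le {vmin vmax a₀ β L : ℝ} (hS : S.CondBasic) (hS1 : S.CondS1 vmin vmax)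
    (hLp2 : S.CondLp2 a₀) (hLp3 : S.CondLp3 x) (hn : 0 < n) (hvmin : 0 < vmin) (ha₀ : 0 < a₀)
    (hβ : 0 < β) (hL : 0 ≤ L) (hx : x ∈ Set.Ioo (0 : ℝ) 1) {k : ℕ} (hk : k ∈ Finset.Icc 1 S.K)
    {g : Fin n → ℝ} (hg : ∀ i, |g i| ≤ L * |S.X i - x| ^ β) :
    ∑ i ∈ Finset.univ.filter (fun i => S.w k i ≠ 0), g i ^ 2 / S.varModel i
      ≤ 2 * a₀ / vmin * (n * S.h k ^ (2 * β + 1) * L ^ 2) := by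
  have hh := hS.h_pos hn hk
  have hn' : (0 : ℝ) < n := by exact_mod_cast hn
  set A := Finset.univ.filter (fun i => S.w k i ≠ 0) with hA
  have hloc : ∀ i ∈ A, |S.X i - x| ≤ S.h k := fun i hi => by
    by_contra hcon
    push Not at hcon
    exact (Finset.mem_filter.1 hi).2 (hLp3 k hk i hcon)
  have hcard : (A.card : ℝ) ≤ 2 * a₀ * n * S.h k := by
    have h1 := hLp2 (max (x - S.h k) 0) (min (x + S.h k) 1) (le_max_right _ _)
      (max_le (le_min (by linarith) (by linarith [hx.2])) (le_min (by linarith [hx.1]) zero_le_one))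
      (min_le_right _ _)
    have h2 : (A.card : ℝ) ≤
        {i | S.X i ∈ Set.Icc (max (x - S.h k) 0) (min (x + S.h k) 1)}.ncard := by
      rw [← Set.ncard_coe_finset]
      refine Nat.cast_le.2 (Set.ncard_le_ncard (fun i hi => ?_) (Set.toFinite _))
      have h3 := abs_le.1 (hloc i hi)
      have h4 := hS.2.1 i
      exact ⟨max_le (by linarith) h4.1, le_min (by linarith) h4.2⟩
    -- The clipped window has length at most `2 h_k`, and `1/n ≤ 2 h_k` because `h_k ≥ 1/(2n)`.
    have h3 : max (min (x + S.h k) 1 - max (x - S.h k) 0) (1 / (n : ℝ)) ≤ 2 * S.h k := by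
      refine max_le ?_ ?_
      · have := min_le_left (x + S.h k) 1
        have := le_max_left (x - S.h k) 0
        linarith
      · have h4 := hS.h_ge hk
        have : 1 / (n : ℝ) = 2 * (1 / (2 * (n : ℝ))) := by field_simp
        linarith
    rw [one_div, inv_mul_le_iff₀ hn'] at h1
    calc (A.card : ℝ) ≤ _ := h2
      _ ≤ _ := h1
      _ ≤ n * (a₀ * (2 * S.h k)) := by rw [← one_div]; gcongr
      _ = _ := by ring
  have hterm : ∀ i ∈ A, g i ^ 2 / S.varModel i ≤ (L * S.h k ^ β) ^ 2 / vmin := fun i hi => by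
    refine div_le_div₀ (sq_nonneg _) ?_ hvmin (hS1 i).1
    rw [← sq_abs (g i)]
    refine pow_le_pow_left₀ (abs_nonneg _) ((hg i).trans ?_) 2
    exact mul_le_mul_of_nonneg_left (Real.rpow_le_rpow (abs_nonneg _) (hloc i hi) hβ.le) hL
  calc ∑ i ∈ A, g i ^ 2 / S.varModel i ≤ A.card • ((L * S.h k ^ β) ^ 2 / vmin) :=
        Finset.sum_le_card_nsmul _ _ _ hterm
    _ ≤ 2 * a₀ * n * S.h k * ((L * S.h k ^ β) ^ 2 / vmin) := by
        rw [nsmul_eq_mul]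
        gcongr
    _ = _ := by
        rw [mul_pow, ← Real.rpow_mul_natCast hh.le, Real.rpow_add_one hh.ne', Nat.cast_ofNat,
          mul_comm β 2]
        ring

/-- The number of scales grows at most logarithmically. -/
lemma pow_le_of_condB {u₀ u vmin vmax lam₀ : ℝ} (hS : S.CondBasic) (hB : S.CondB ℓ x u₀ u)
    (hS1 : S.CondS1 vmin vmax) (hLp1 : S.CondLp1 ℓ x lam₀ vmax) (hn : 0 < n) (hvmin : 0 < vmin)
    (hvmax : 0 < vmax) (hlam : 0 < lam₀) (hu₀ : 1 < u₀) :
    u₀ ^ (S.K - 1) ≤ 2 * vmax / (lam₀ * vmin) * n := by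
  have hn' : (0 : ℝ) < n := by exact_mod_cast hn
  set e : Fin (ℓ + 1) → ℝ := Pi.single 0 1 with he
  -- The `(1,1)` entry of `B_k` grows at least by the factor `u₀` per scale. It starts above `lam₀ /
  -- (2 vmax)`, as `n h_1 ≥ 1/2`, and ends below `n / vmin`, as the weights are at most `1`.
  have hstep : ∀ j, j + 1 ≤ S.K → u₀ ^ j * (e ⬝ᵥ (S.B ℓ x 1 *ᵥ e))
      ≤ e ⬝ᵥ (S.B ℓ x (j + 1) *ᵥ e) := by
    intro j
    induction j with
    | zero => intro _; simp
    | succ j ih =>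
      intro hj
      have h1 := (hB (j + 1 + 1) (by omega) hj).1.dotProduct_mulVec_nonneg e
      rw [Matrix.sub_mulVec, dotProduct_sub, Matrix.smul_mulVec, dotProduct_smul, star_trivial,
        smul_eq_mul, sub_nonneg, Nat.add_sub_cancel] at h1
      refine le_trans ?_ h1
      rw [pow_succ', mul_assoc]
      exact mul_le_mul_of_nonneg_left (ih (by omega)) (by linarith)
  have h1 := hstep (S.K - 1) (by have := hS.1; omega)
  rw [Nat.sub_add_cancel hS.1] at h1
  have h2 : lam₀ / (2 * vmax) ≤ e ⬝ᵥ (S.B ℓ x 1 *ᵥ e) := by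
    have h3 := hLp1.le_quadForm hS hn hlam hvmax (Finset.mem_Icc.2 ⟨le_rfl, hS.1⟩) e
    refine le_trans ?_ h3
    have h4 := hS.2.2.2.1
    have h5 : 1 / 2 ≤ (n : ℝ) * S.h 1 := by
      rw [div_le_iff₀ (by positivity)] at h4
      linarith
    simp only [he, Pi.single_eq_same, one_pow, mul_one]
    rw [div_le_div_iff₀ (by positivity) hvmax]
    nlinarith [mul_pos hlam hvmax]
  have h3 : e ⬝ᵥ (S.B ℓ x S.K *ᵥ e) ≤ n / vmin := by
    rw [dotProduct_B_mulVec]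
    have h4 : ∀ i ∈ Finset.univ, ((S.Psi ℓ x)ᵀ *ᵥ e) i * ((S.Psi ℓ x)ᵀ *ᵥ e) i
        * (S.w S.K i / (S.varModel i : ℝ)) ≤ 1 / vmin := fun i _ => by
      have h5 : ((S.Psi ℓ x)ᵀ *ᵥ e) i = 1 := by
        rw [he, Matrix.mulVec_single_one]
        simp [Psi]
      have h6 := hS.2.2.1 S.K (Finset.mem_Icc.2 ⟨hS.1, le_rfl⟩) i
      rw [h5, one_mul, one_mul]
      exact div_le_div₀ zero_le_one h6.2 hvmin (hS1 i).1
    refine (Finset.sum_le_card_nsmul _ _ _ h4).trans (le_of_eq ?_)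
    simp [div_eq_mul_inv]
  have h4 : u₀ ^ (S.K - 1) * (lam₀ / (2 * vmax)) ≤ n / vmin :=
    (mul_le_mul_of_nonneg_left h2 (by positivity)).trans (h1.trans h3)
  rw [← le_div_iff₀ (by positivity)] at h4
  refine h4.trans (le_of_eq ?_)
  field_simp

end LocPoly.Scheme

/-! ### Propagation under the true law and the risk decomposition -/

namespace LocPoly.Scheme

variable {n : ℕ} {S : Scheme n} {ℓ : ℕ} {x : ℝ}

/-- The squared distance between the estimator at scale `k` and the last accepted one. -/
noncomputable def propagationStat (S : Scheme n) (ℓ : ℕ) (x : ℝ) (k : ℕ) (y : Fin n → ℝ) : ℝ :=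
  (S.qmle ℓ x k y - S.lastAccepted ℓ x k y) ⬝ᵥ
    (S.B ℓ x k *ᵥ (S.qmle ℓ x k y - S.lastAccepted ℓ x k y))

lemma measurable_propagationStat (hK : 1 ≤ S.K) (k : ℕ) :
    Measurable (S.propagationStat ℓ x k) := by
  have h : Continuous fun d : Fin (ℓ + 1) → ℝ => d ⬝ᵥ (S.B ℓ x k *ᵥ d) :=
    continuous_id.dotProduct (continuous_const.matrix_mulVec continuous_id)
  exact h.measurable.comp ((S.measurable_qmle ℓ x k).sub (S.measurable_lastAccepted ℓ x hK k))

/-- The propagation property carries over to the true law on the scales with a small bias. -/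
lemma lintegral_propagationStat_le {r α δ bd : ℝ} (hr : 0 < r) (hα : 0 ≤ α) (hS : S.CondBasic)
    (hPC : S.CondPC ℓ x r α) (hCS : S.CondS δ) (hδ0 : 0 ≤ δ) (hδ1 : δ < 1)
    (hv : ∀ i, (0 : ℝ) < S.varModel i) (hW : S.CondW)
    (hdet : ∀ l ∈ Finset.Icc 1 S.K, IsUnit (S.B ℓ x l).det) {k : ℕ} (hk2 : 2 ≤ k) (hkK : k ≤ S.K)
    (f : ℝ → ℝ) (θ : Fin (ℓ + 1) → ℝ)
    (hbd : ∑ i ∈ Finset.univ.filter (fun i => S.w k i ≠ 0),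
      (f (S.X i) - ((S.Psi ℓ x)ᵀ *ᵥ θ) i) ^ 2 / S.varModel i ≤ bd) :
    ∫⁻ y, ENNReal.ofReal (|S.propagationStat ℓ x k y| ^ (r / 2)) ∂S.trueLaw f
      ≤ ENNReal.ofReal (α * chiSqMoment (ℓ + 1) r
          + Real.exp (bd / (1 - δ)) * (1 / Real.sqrt (1 - δ ^ 2)) ^ (k * (ℓ + 1))) := by
  have hK := hS.1
  have hmem : ∀ l, 1 ≤ l → l ≤ k → l ∈ Finset.Icc 1 S.K := fun l h1 h2 =>
    Finset.mem_Icc.2 ⟨h1, h2.trans hkK⟩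
  have hdet' : ∀ l, 1 ≤ l → l ≤ k → IsUnit (S.B ℓ x l).det := fun l h1 h2 =>
    hdet l (hmem l h1 h2)
  set G : (Fin n → ℝ) → ℝ≥0∞ := fun y =>
    ENNReal.ofReal (|S.propagationStat ℓ x k y| ^ (r / 2)) with hGdef
  have hG : Measurable G := by
    have := S.measurable_propagationStat (ℓ := ℓ) (x := x) hK k
    fun_prop
  have hcongr : ∀ (y y' : Fin n → ℝ) (θ : Fin (ℓ + 1) → ℝ),
      (∀ l, 1 ≤ l → l ≤ k → S.qmle ℓ x l y = S.qmle ℓ x l y' + θ) → G y = G y' :=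
    fun y y' θ h => by
      simp only [hGdef, propagationStat]
      rw [qmle_sub_lastAccepted_congr hK (by omega) hkK hdet' θ h]
  set c : Fin n → ℝ := (S.Psi ℓ x)ᵀ *ᵥ θ with hc
  -- Subtracting the polynomial trend leaves `G` unchanged and reduces the mean to the Taylor
  -- remainder.
  have hshift : ∀ y, G y = G (fun i => y i - c i) := fun y => by
    refine hcongr _ _ θ fun l h1 h2 => ?_
    rw [← qmle_add_mulVec (hdet' l h1 h2)]
    congr 1
    ext i
    simp [hc]
  have hlaw : (S.trueLaw f).map (fun y i => y i - c i)
      = Measure.pi fun i => gaussianReal (f (S.X i) - c i) (S.varTrue i) := by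
    have hp : ∀ i, (gaussianReal (f (S.X i)) (S.varTrue i)).map (fun t => t - c i)
        = gaussianReal (f (S.X i) - c i) (S.varTrue i) := fun i => gaussianReal_map_sub_const _
    have hsf : ∀ i, SigmaFinite ((gaussianReal (f (S.X i)) (S.varTrue i)).map (fun t => t - c i)) :=
      fun i => by rw [hp]; infer_instance
    rw [trueLaw, Measure.pi_map_pi (f := fun i t => t - c i) fun i => by fun_prop]
    simp_rw [hp]
  have e1 : ∫⁻ y, G y ∂S.trueLaw f
      = ∫⁻ y, G y ∂(Measure.pi fun i => gaussianReal (f (S.X i) - c i) (S.varTrue i)) := by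
    rw [← hlaw, lintegral_map hG (by fun_prop)]
    exact lintegral_congr hshift
  -- `G` is a function of the vectors `Ψ W_l y`, `l ≤ k`; scale `l` has index `l - 1` in `Fin k`. By
  -- `(W)` all these functionals live on the support of `w_k`.
  have main := lintegral_pi_gaussianReal_le_of_linear
    (κ := Fin k × Fin (ℓ + 1))
    (fun p i => S.Psi ℓ x p.2 i * (S.w (p.1 + 1) i / (S.varModel i : ℝ)))
    (Finset.univ.filter (fun i => S.w k i ≠ 0)) (fun p i hi => by
      have h0 : S.w k i = 0 := by simpa using hi
      have hp := p.1.2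
      have h1 := hW (p.1 + 1) k (by omega) (by omega) hkK i
      have h2 := (hS.2.2.1 _ (hmem (p.1 + 1) (by omega) (by omega)) i).1
      have h3 : S.w (p.1 + 1) i = 0 := by linarith
      simp [h3])
    (fun i => f (S.X i) - c i) S.varModel S.varTrue δ hδ0 hδ1
    (fun i h => by have := hv i; simp [h] at this) (fun i => (hCS i).1) (fun i => (hCS i).2)
    G hG (fun y y' h => hcongr y y' 0 fun l h1 h2 => by
      rw [add_zero, qmle, qmle]
      congr 1
      ext j
      rw [Psi_W_mulVec_apply, Psi_W_mulVec_apply]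
      have := h (⟨l - 1, by omega⟩, j)
      simpa only [Nat.sub_add_cancel h1] using this)
  -- The power `r / 2` in `G` makes `G²` the integrand of the propagation condition.
  have hsq : ∀ y, G y ^ 2 = ENNReal.ofReal (|S.propagationStat ℓ x k y| ^ r) := fun y => by
    rw [hGdef, ← ENNReal.ofReal_pow (by positivity), ← Real.rpow_mul_natCast (abs_nonneg _)]
    congr 2
    push_cast
    ring
  have hchi : 0 ≤ chiSqMoment (ℓ + 1) r := by
    unfold chiSqMoment
    have h1 : 0 < Real.Gamma (r + ((ℓ + 1 : ℕ) : ℝ) / 2) := Real.Gamma_pos_of_pos (by positivity)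
    have h2 : 0 < Real.Gamma (((ℓ + 1 : ℕ) : ℝ) / 2) := Real.Gamma_pos_of_pos (by positivity)
    positivity
  rw [e1]
  refine main.trans ?_
  rw [ENNReal.ofReal_add (by positivity) (by positivity)]
  simp_rw [hsq]
  refine add_le_add (hPC k hk2 hkK) (ENNReal.ofReal_le_ofReal ?_)
  have : 0 < 1 - δ := by linarith
  rw [Fintype.card_prod, Fintype.card_fin, Fintype.card_fin]
  gcongr

/-- The law of the estimation error at a fixed scale. -/
lemma map_qmle_sub {k : ℕ} {a : Fin n → ℝ} (ha : ∀ y, S.qmle ℓ x k y 0 = ∑ i, a i * y i)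
    (f : ℝ → ℝ) :
    (S.trueLaw f).map (fun y => S.qmle ℓ x k y 0 - f x)
      = gaussianReal (S.bias ℓ x f k) (∑ i, (a i ^ 2).toNNReal * S.varTrue i) := by
  have h : (fun y => S.qmle ℓ x k y 0 - f x) = (fun t => t - f x) ∘ fun y => ∑ i, a i * y i := by
    ext y
    simp [ha]
  rw [h, ← Measure.map_map (by fun_prop) (by fun_prop), trueLaw, map_pi_gaussianReal_sum,
    gaussianReal_map_sub_const, bias, ha]

lemma stdDev_eq {k : ℕ} {a : Fin n → ℝ} (ha : ∀ y, S.qmle ℓ x k y 0 = ∑ i, a i * y i)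
    (f : ℝ → ℝ) :
    S.stdDev ℓ x f k = Real.sqrt (∑ i, (a i ^ 2).toNNReal * S.varTrue i : ℝ≥0) := by
  rw [stdDev]
  congr 1
  have h : (fun y => S.qmle ℓ x k y 0) = id ∘ fun y => ∑ i, a i * y i := by
    ext y
    simp [ha]
  rw [h, ← variance_map (by fun_prop)
    (Measurable.aemeasurable (by fun_prop)), trueLaw, map_pi_gaussianReal_sum,
    variance_id_gaussianReal]

/-- The factor `√2` absorbs the misspecification: `1 + δ < 2`. -/
lemma sqrt_var_le {a : Fin n → ℝ} {κ δ : ℝ} (hCS : S.CondS δ) (hδ1 : δ < 1)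
    (hv : ∀ i, (0 : ℝ) < S.varModel i) (ha : ∑ i, a i ^ 2 * S.varModel i ≤ 1 / κ) :
    Real.sqrt (∑ i, (a i ^ 2).toNNReal * S.varTrue i : ℝ≥0) ≤ Real.sqrt 2 * (1 / Real.sqrt κ) := by
  rw [← Real.sqrt_one, ← Real.sqrt_div zero_le_one, ← Real.sqrt_mul zero_le_two]
  refine Real.sqrt_le_sqrt ?_
  push_cast
  calc ∑ i, ((a i ^ 2).toNNReal : ℝ) * S.varTrue i ≤ ∑ i, 2 * (a i ^ 2 * S.varModel i) := by
        refine Finset.sum_le_sum fun i _ => ?_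
        rw [Real.coe_toNNReal _ (sq_nonneg _)]
        have h1 := (hCS i).2
        rw [div_le_iff₀ (hv i)] at h1
        have h2 := hv i
        have : (S.varTrue i : ℝ) ≤ 2 * S.varModel i := by nlinarith
        nlinarith [sq_nonneg (a i)]
    _ = 2 * ∑ i, a i ^ 2 * S.varModel i := by rw [Finset.mul_sum]
    _ ≤ _ := by gcongr

lemma abs_bias_one_le_supBias (f : ℝ → ℝ) : |S.bias ℓ x f 1| ≤ S.supBias ℓ x f 1 := by
  have h := le_ciSup (f := fun l : (Set.Icc 1 1 : Set ℕ) => |S.bias ℓ x f l|)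
    (Set.finite_range _).bddAbove ⟨1, Set.mem_Icc.2 ⟨le_rfl, le_rfl⟩⟩
  exact h

/-- The Taylor polynomial is reproduced and takes the value `f x` at `x`. The bias is therefore a
linear functional of the remainder, to which Cauchy–Schwarz applies. -/
lemma abs_bias_le {k : ℕ} {a : Fin n → ℝ} {κ bd : ℝ}
    (hdet : IsUnit (S.B ℓ x k).det) (ha : ∀ y, S.qmle ℓ x k y 0 = ∑ i, a i * y i)
    (hav : ∑ i, a i ^ 2 * S.varModel i ≤ 1 / κ) (haw : ∀ i, S.w k i = 0 → a i = 0)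
    (hv : ∀ i, (0 : ℝ) < S.varModel i) (f : ℝ → ℝ) (θ : Fin (ℓ + 1) → ℝ) (hθ : θ 0 = f x)
    (hbd : ∑ i ∈ Finset.univ.filter (fun i => S.w k i ≠ 0),
      (f (S.X i) - ((S.Psi ℓ x)ᵀ *ᵥ θ) i) ^ 2 / S.varModel i ≤ bd) :
    |S.bias ℓ x f k| ≤ Real.sqrt bd * (1 / Real.sqrt κ) := by
  have h1 : S.bias ℓ x f k = ∑ i, a i * (f (S.X i) - ((S.Psi ℓ x)ᵀ *ᵥ θ) i) := by
    rw [← ha, bias]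
    have : (fun i => f (S.X i)) = (fun i => f (S.X i) - ((S.Psi ℓ x)ᵀ *ᵥ θ) i)
        + (S.Psi ℓ x)ᵀ *ᵥ θ := by
      ext i
      simp
    rw [this, qmle_add_mulVec hdet, Pi.add_apply, hθ, add_sub_cancel_right]
  have hbd0 : 0 ≤ bd := (Finset.sum_nonneg fun i _ => by have := hv i; positivity).trans hbd
  rw [← Real.sqrt_one, ← Real.sqrt_div zero_le_one, ← Real.sqrt_mul hbd0]
  refine Real.abs_le_sqrt ?_
  rw [h1]
  refine (row_sum_sq_le hv (Finset.univ.filter (fun i => S.w k i ≠ 0))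
    fun i hi => haw i (by simpa using hi)).trans ?_
  rw [mul_comm]
  exact mul_le_mul hbd hav (Finset.sum_nonneg fun i _ => by have := hv i; positivity) hbd0

/-- Risk bound in terms of a reference scale `k`. -/
lemma risk_le {r κ zz CD CB : ℝ} (hr : 0 < r) (hκ : 0 < κ) (hCD : 0 ≤ CD)
    (hCB : 0 ≤ CB) (hK : 1 ≤ S.K) (hdet : ∀ l ∈ Finset.Icc 1 S.K, IsUnit (S.B ℓ x l).det) {k : ℕ}
    (hk : k ∈ Finset.Icc 1 S.K)
    (hquad : ∀ d : Fin (ℓ + 1) → ℝ, κ * d 0 ^ 2 ≤ d ⬝ᵥ (S.B ℓ x k *ᵥ d))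
    (hz : k < S.K → S.z k ≤ zz) (f : ℝ → ℝ)
    (hD : ∫⁻ y, ENNReal.ofReal (|S.qmle ℓ x k y 0 - f x| ^ r) ∂S.trueLaw f
      ≤ ENNReal.ofReal (CD * (1 / Real.sqrt κ) ^ r))
    (hB : ∫⁻ y, ENNReal.ofReal (|S.propagationStat ℓ x k y| ^ (r / 2)) ∂S.trueLaw f
      ≤ ENNReal.ofReal CB) :
    ∫⁻ y, ENNReal.ofReal (|f x - S.fhat ℓ x y| ^ r) ∂S.trueLaw f
      ≤ ENNReal.ofReal (3 ^ r * (1 / Real.sqrt κ) ^ r * (Real.sqrt zz ^ r + CB + CD)) := by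
  set q := 1 / Real.sqrt κ with hqdef
  have hq : 0 < q := by positivity
  have hfirst : ∀ (d : Fin (ℓ + 1) → ℝ) (t : ℝ), d ⬝ᵥ (S.B ℓ x k *ᵥ d) ≤ t →
      |d 0| ≤ q * Real.sqrt t := fun d t ht => by
    have h1 : d 0 ^ 2 ≤ t / κ := by
      rw [le_div_iff₀ hκ]
      linarith [hquad d]
    refine (Real.abs_le_sqrt h1).trans (le_of_eq ?_)
    rw [Real.sqrt_div' _ hκ.le, hqdef]
    ring
  have hpt : ∀ y, |f x - S.fhat ℓ x y| ^ r ≤ 3 ^ r * (q ^ r * Real.sqrt zz ^ r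
      + (q ^ r * |S.propagationStat ℓ x k y| ^ (r / 2) + |S.qmle ℓ x k y 0 - f x| ^ r)) := by
    intro y
    set a := |S.fhat ℓ x y - S.lastAccepted ℓ x k y 0| with hadef
    set b := |S.qmle ℓ x k y 0 - S.lastAccepted ℓ x k y 0| with hbdef
    set d := |S.qmle ℓ x k y 0 - f x| with hddef
    have hmem := khat_mem (ℓ := ℓ) (x := x) hK y
    have ha : a ≤ q * Real.sqrt zz := by
      -- If selection stops by `k`, the two estimators coincide; otherwise scale `k` was tested
      -- successfully against `k̂`.
      rcases le_or_gt (S.khat ℓ x y) k with hle | hlt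
      · have : a = 0 := by rw [hadef, fhat, lastAccepted, min_eq_right hle, sub_self, abs_zero]
        rw [this]
        positivity
      · have h1 := hmem.2.2 k _ (Finset.mem_Icc.1 hk).1 hlt le_rfl
        rw [T_eq (hdet k hk)] at h1
        have h2 := hfirst _ zz (h1.trans (hz (hlt.trans_le hmem.2.1)))
        rwa [hadef, fhat, lastAccepted, min_eq_left hlt.le, abs_sub_comm]
    have hb : b ≤ q * Real.sqrt |S.propagationStat ℓ x k y| :=
      hfirst (S.qmle ℓ x k y - S.lastAccepted ℓ x k y) _ (le_abs_self _)
    have hbr : b ^ r ≤ q ^ r * |S.propagationStat ℓ x k y| ^ (r / 2) := by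
      refine (Real.rpow_le_rpow (abs_nonneg _) hb hr.le).trans (le_of_eq ?_)
      rw [Real.mul_rpow hq.le (Real.sqrt_nonneg _), Real.sqrt_eq_rpow,
        ← Real.rpow_mul (abs_nonneg _)]
      congr 2
      ring
    have har : a ^ r ≤ q ^ r * Real.sqrt zz ^ r := by
      rw [← Real.mul_rpow hq.le (Real.sqrt_nonneg _)]
      exact Real.rpow_le_rpow (abs_nonneg _) ha hr.le
    have htri : |f x - S.fhat ℓ x y| ≤ a + b + d := by
      have e : f x - S.fhat ℓ x y = -(S.fhat ℓ x y - S.lastAccepted ℓ x k y 0)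
          + (S.qmle ℓ x k y 0 - S.lastAccepted ℓ x k y 0) + -(S.qmle ℓ x k y 0 - f x) := by ring
      rw [e]
      refine (abs_add_three _ _ _).trans (le_of_eq ?_)
      rw [abs_neg, abs_neg]
    have h0a : 0 ≤ a := abs_nonneg _
    have h0b : 0 ≤ b := abs_nonneg _
    have h0d : 0 ≤ d := abs_nonneg _
    -- Passing through the maximum handles every `r > 0`, including `r < 1`, without convexity.
    have hmax : |f x - S.fhat ℓ x y| ≤ 3 * max a (max b d) := by
      have := le_max_left a (max b d)
      have := (le_max_left b d).trans (le_max_right a (max b d))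
      have := (le_max_right b d).trans (le_max_right a (max b d))
      linarith
    have h0m : 0 ≤ max a (max b d) := h0a.trans (le_max_left _ _)
    refine (Real.rpow_le_rpow (abs_nonneg _) hmax hr.le).trans ?_
    rw [Real.mul_rpow zero_le_three h0m]
    refine mul_le_mul_of_nonneg_left ?_ (by positivity)
    have h1 : 0 ≤ a ^ r := by positivity
    have h2 : 0 ≤ b ^ r := by positivity
    have h3 : 0 ≤ d ^ r := by positivity
    rcases max_choice a (max b d) with h | h
    · rw [h]; linarith
    · rw [h]
      rcases max_choice b d with h | h <;> rw [h] <;> linarith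
  have hmP := S.measurable_propagationStat (ℓ := ℓ) (x := x) hK k
  calc ∫⁻ y, ENNReal.ofReal (|f x - S.fhat ℓ x y| ^ r) ∂S.trueLaw f
      ≤ ∫⁻ y, ENNReal.ofReal (3 ^ r) * (ENNReal.ofReal (q ^ r * Real.sqrt zz ^ r)
          + (ENNReal.ofReal (q ^ r) * ENNReal.ofReal (|S.propagationStat ℓ x k y| ^ (r / 2))
            + ENNReal.ofReal (|S.qmle ℓ x k y 0 - f x| ^ r))) ∂S.trueLaw f := by
        refine lintegral_mono fun y => ?_
        rw [← ENNReal.ofReal_mul (by positivity), ← ENNReal.ofReal_add (by positivity)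
          (by positivity), ← ENNReal.ofReal_add (by positivity) (by positivity),
          ← ENNReal.ofReal_mul (by positivity)]
        exact ENNReal.ofReal_le_ofReal (hpt y)
    _ = ENNReal.ofReal (3 ^ r) * (ENNReal.ofReal (q ^ r * Real.sqrt zz ^ r)
          + (ENNReal.ofReal (q ^ r) *
              ∫⁻ y, ENNReal.ofReal (|S.propagationStat ℓ x k y| ^ (r / 2)) ∂S.trueLaw f
            + ∫⁻ y, ENNReal.ofReal (|S.qmle ℓ x k y 0 - f x| ^ r) ∂S.trueLaw f)) := by
        have : IsProbabilityMeasure (S.trueLaw f) := by unfold trueLaw; infer_instance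
        rw [lintegral_const_mul _ (by fun_prop), lintegral_add_left (by fun_prop),
          lintegral_add_left (by fun_prop), lintegral_const_mul _ (by fun_prop), lintegral_const,
          measure_univ, mul_one]
    _ ≤ ENNReal.ofReal (3 ^ r) * (ENNReal.ofReal (q ^ r * Real.sqrt zz ^ r)
          + (ENNReal.ofReal (q ^ r) * ENNReal.ofReal CB + ENNReal.ofReal (CD * q ^ r))) := by
        gcongr
    _ = _ := by
        rw [← ENNReal.ofReal_mul (by positivity), ← ENNReal.ofReal_add (by positivity)
          (by positivity), ← ENNReal.ofReal_add (by positivity) (by positivity),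
          ← ENNReal.ofReal_mul (by positivity)]
        congr 1
        ring

end LocPoly.Scheme

namespace LocPoly.Scheme

variable {n : ℕ} {S : Scheme n} {ℓ : ℕ} {x : ℝ}

/-- Admitting `k = 1` unconditionally makes the set nonempty; failure at the successor is maximality
and needs no monotonicity of `p`. -/
lemma exists_reference_scale {K : ℕ} (hK : 1 ≤ K) (p : ℕ → Prop) :
    ∃ k ∈ Finset.Icc 1 K, (k = 1 ∨ p k) ∧ (k < K → ¬ p (k + 1)) := by
  classical
  have hne : ((Finset.Icc 1 K).filter fun k => k = 1 ∨ p k).Nonempty :=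
    ⟨1, Finset.mem_filter.2 ⟨Finset.mem_Icc.2 ⟨le_rfl, hK⟩, Or.inl rfl⟩⟩
  obtain ⟨hm, hp⟩ := Finset.mem_filter.1 (Finset.max'_mem _ hne)
  refine ⟨_, hm, hp, fun hlt hcon => ?_⟩
  have h1 := Finset.le_max' _ _ (Finset.mem_filter.2
    ⟨Finset.mem_Icc.2 ⟨by omega, hlt⟩, Or.inr hcon⟩ :
      _ ∈ (Finset.Icc 1 K).filter fun k => k = 1 ∨ p k)
  omega

/-- Risk bound at a reference scale whose bias is of the order of the standard deviation. -/
lemma risk_le_of_reference {r α δ β L M vmin vmax lam₀ a₀ Cw κ zz CD b : ℝ}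
    (hr : 0 < r) (hα : 0 ≤ α) (hβ : (ℓ : ℝ) < β) (hL : 0 ≤ L) (hx : x ∈ Set.Ioo (0 : ℝ) 1)
    (hn : 0 < n) (hvmin : 0 < vmin) (hvmax : 0 < vmax) (hlam : 0 < lam₀) (ha₀ : 0 < a₀)
    (hCw : 0 < Cw) (hδ0 : 0 ≤ δ) (hδ1 : δ < 1)
    (hS : S.CondBasic) (hPC : S.CondPC ℓ x r α) (hCS : S.CondS δ) (hS1 : S.CondS1 vmin vmax)
    (hLp1 : S.CondLp1 ℓ x lam₀ vmax) (hLp2 : S.CondLp2 a₀) (hLp3 : S.CondLp3 x) (hW : S.CondW)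
    (hP : S.CondProd) {f : ℝ → ℝ} (hf : f ∈ HolderClass ℓ β L) (hfa : S.FirstAccepted ℓ x f Cw)
    {k : ℕ} (hk : k ∈ Finset.Icc 1 S.K)
    (hkM : k = 1 ∨ n * S.h k ^ (2 * β + 1) * L ^ 2 ≤ M) (hκ : 0 < κ)
    (hquad : ∀ d : Fin (ℓ + 1) → ℝ, κ * d 0 ^ 2 ≤ d ⬝ᵥ (S.B ℓ x k *ᵥ d))
    (hz : k < S.K → S.z k ≤ zz) (hCD0 : 0 ≤ CD)
    (hCD : ∀ (q m : ℝ) (v : ℝ≥0), 0 ≤ q →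
      |m| ≤ (Real.sqrt (2 * a₀ / vmin * M) + Cw * Real.sqrt 2) * q → Real.sqrt v ≤ Real.sqrt 2 * q →
      ∫⁻ z, ENNReal.ofReal (|z| ^ r) ∂gaussianReal m v ≤ ENNReal.ofReal (CD * q ^ r))
    (hb : α * chiSqMoment (ℓ + 1) r + Real.exp (2 * a₀ / vmin * M / (1 - δ))
      * (1 / Real.sqrt (1 - δ ^ 2)) ^ (k * (ℓ + 1)) ≤ b) (hb0 : 0 ≤ b) :
    ∫⁻ y, ENNReal.ofReal (|f x - S.fhat ℓ x y| ^ r) ∂S.trueLaw f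
      ≤ ENNReal.ofReal (3 ^ r * (1 / Real.sqrt κ) ^ r * (Real.sqrt zz ^ r + b + CD)) := by
  have hβ0 : 0 < β := lt_of_le_of_lt (Nat.cast_nonneg ℓ) hβ
  have hdet : ∀ l ∈ Finset.Icc 1 S.K, IsUnit (S.B ℓ x l).det := fun l hl =>
    hLp1.isUnit_det hS hn hlam hvmax hl
  have hv : ∀ i, (0 : ℝ) < S.varModel i := fun i => hvmin.trans_le (hS1 i).1
  obtain ⟨θ, hθ0, hθ⟩ := HolderClass.exists_taylor hβ hL hf ⟨hx.1.le, hx.2.le⟩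
  have hg : ∀ i, |f (S.X i) - ((S.Psi ℓ x)ᵀ *ᵥ θ) i| ≤ L * |S.X i - x| ^ β := fun i => by
    have := hθ (S.X i) (hS.2.1 i)
    simpa [Matrix.mulVec, dotProduct, Psi] using this
  have hrem := sum_remainder_le hS hS1 hLp2 hLp3 hn hvmin ha₀ hβ0 hL hx hk hg
  have hbd : k ≠ 1 → ∑ i ∈ Finset.univ.filter (fun i => S.w k i ≠ 0),
      (f (S.X i) - ((S.Psi ℓ x)ᵀ *ᵥ θ) i) ^ 2 / S.varModel i ≤ 2 * a₀ / vmin * M := fun h1 =>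
    hrem.trans (mul_le_mul_of_nonneg_left (hkM.resolve_left h1) (by positivity))
  obtain ⟨a, ha, hav, haw⟩ := exists_row (hdet k hk) hκ hquad (hP.sq_eq hk) hv
  have hsd := sqrt_var_le hCS hδ1 hv hav
  have hq : 0 < 1 / Real.sqrt κ := by positivity
  have hbias : |S.bias ℓ x f k|
      ≤ (Real.sqrt (2 * a₀ / vmin * M) + Cw * Real.sqrt 2) * (1 / Real.sqrt κ) := by
    have h2 : 0 ≤ Real.sqrt (2 * a₀ / vmin * M) * (1 / Real.sqrt κ) := by positivity
    have h3 : 0 ≤ Cw * Real.sqrt 2 * (1 / Real.sqrt κ) := by positivity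
    -- Scale `1` need not satisfy the bandwidth condition; acceptance of the first scale bounds its
    -- bias instead.
    by_cases h1 : k = 1
    · subst h1
      have h4 := (S.abs_bias_one_le_supBias (ℓ := ℓ) (x := x) f).trans hfa
      rw [stdDev_eq ha] at h4
      have h5 := h4.trans (mul_le_mul_of_nonneg_left hsd hCw.le)
      linarith
    · have h4 := abs_bias_le (hdet k hk) ha hav haw hv f θ hθ0 (hbd h1)
      linarith
  refine risk_le hr hκ hCD0 hb0 hS.1 hdet hk hquad hz f ?_ ?_
  · have h1 := hCD _ _ _ hq.le hbias hsd
    rw [← map_qmle_sub ha, lintegral_map (by fun_prop) (by fun_prop)] at h1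
    exact h1
  · by_cases h1 : k = 1
    · subst h1
      have h2 : ∀ y, S.propagationStat ℓ x 1 y = 0 := fun y => by
        have h3 := (khat_mem (ℓ := ℓ) (x := x) hS.1 y).1
        rw [propagationStat, lastAccepted, min_eq_left h3, sub_self, zero_dotProduct]
      simp_rw [h2]
      simp [Real.zero_rpow (by positivity : r / 2 ≠ 0)]
    · have hk' := Finset.mem_Icc.1 hk
      exact (lintegral_propagationStat_le hr hα hS hPC hCS hδ0 hδ1 hv hW hdet (by omega) hk'.2 f θ
        (hbd h1)).trans (ENNReal.ofReal_le_ofReal hb)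

end LocPoly.Scheme

/-! ### Critical values, rates and bandwidths -/

namespace LocPoly

/-- The expression is linear in `K` up to `log (K/α) ≤ K/α` and a constant, which `t ≥ 1` absorbs.
With `t = log n` the critical values are `O(log n)`. -/
lemma exists_theoreticalCrit_le {p : ℕ} {r α μ u a : ℝ} (hr : 0 < r) (hα : 0 < α) (hμ : 0 < μ)
    (hu : 1 ≤ u) (ha : 0 < a) :
    ∃ A, 0 < A ∧ ∀ (K k : ℕ) (t : ℝ), 1 ≤ t → (K : ℝ) ≤ a * t →
      theoreticalCrit p r α μ u K k ≤ A * t := by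
  obtain ⟨c, hc⟩ : ∃ c, c = -(p / 4 * Real.log (1 - 4 * μ)) - Real.log (1 - u ^ (-r))
    + Real.log (2 ^ (2 * r) * Real.sqrt (Real.Gamma (2 * r + p / 2) * Real.Gamma (p / 2))
        / Real.Gamma (r + p / 2)) := ⟨_, rfl⟩
  have hlu : 0 ≤ Real.log u := Real.log_nonneg hu
  refine ⟨4 / μ * ((r * Real.log u + 1 / α) * a + |c|), by positivity, fun K k t ht hK => ?_⟩
  have h1 : Real.log (K / α) ≤ 1 / α * (a * t) := by
    refine (Real.log_le_self (by positivity)).trans ?_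
    rw [div_eq_mul_one_div, mul_comm]
    gcongr
  have h2 : r * ((K : ℝ) - k) * Real.log u ≤ r * (a * t) * Real.log u := by
    have : (0 : ℝ) ≤ k := k.cast_nonneg
    gcongr
    linarith
  have h3 : c ≤ |c| * t := (le_abs_self c).trans (le_mul_of_one_le_right (abs_nonneg c) ht)
  rw [theoreticalCrit, mul_assoc (4 / μ) _ t]
  refine mul_le_mul_of_nonneg_left ?_ (by positivity)
  have e : ((r * Real.log u + 1 / α) * a + |c|) * t
      = r * (a * t) * Real.log u + 1 / α * (a * t) + |c| * t := by ring
  rw [e]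
  linarith

lemma one_div_sqrt_le {κ t : ℝ} (hκ : 0 < κ) (ht : 0 ≤ t) (h : 1 ≤ κ * t ^ 2) :
    1 / Real.sqrt κ ≤ t := by
  rw [div_le_iff₀ (Real.sqrt_pos.2 hκ)]
  have h1 : Real.sqrt 1 ≤ Real.sqrt (κ * t ^ 2) := Real.sqrt_le_sqrt h
  rwa [Real.sqrt_one, Real.sqrt_mul hκ.le, Real.sqrt_sq ht, mul_comm] at h1

/-- For `δ ≤ 1/2` the base is at most `exp (2δ)`, and `N δ ≤ a`. This is where `δ = o(1/log n)`
offsets logarithmically many scales. -/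
lemma one_div_sqrt_pow_le {δ a t : ℝ} (hδ0 : 0 ≤ δ) (hδ : δ ≤ 1 / 2) {N : ℕ} (hN : (N : ℝ) ≤ a * t)
    (ha : 0 ≤ a) (hδt : δ * t ≤ 1) :
    (1 / Real.sqrt (1 - δ ^ 2)) ^ N ≤ Real.exp (2 * a) := by
  have h0 : 0 < 1 - δ ^ 2 := by nlinarith
  have hs : 0 < Real.sqrt (1 - δ ^ 2) := Real.sqrt_pos.2 h0
  have h1 : 1 / Real.sqrt (1 - δ ^ 2) ≤ Real.exp (2 * δ) := by
    have h2 : 1 - δ ^ 2 ≤ Real.sqrt (1 - δ ^ 2) := Real.le_sqrt_of_sq_le (by nlinarith)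
    have h3 := Real.add_one_le_exp (2 * δ)
    rw [div_le_iff₀ hs]
    have h4 : 1 ≤ (2 * δ + 1) * (1 - δ ^ 2) := by nlinarith [mul_nonneg hδ0 hδ0]
    exact h4.trans (mul_le_mul h3 h2 h0.le (Real.exp_pos _).le)
  calc (1 / Real.sqrt (1 - δ ^ 2)) ^ N ≤ Real.exp (2 * δ) ^ N :=
        pow_le_pow_left₀ (by positivity) h1 N
    _ = Real.exp (N * (2 * δ)) := (Real.exp_nat_mul _ _).symm
    _ ≤ _ := by
        refine Real.exp_le_exp.2 ?_
        calc (N : ℝ) * (2 * δ) ≤ a * t * (2 * δ) := by gcongr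
          _ = 2 * a * (δ * t) := by ring
          _ ≤ 2 * a * 1 := by gcongr
          _ = 2 * a := mul_one _

/-- The exponent `γ` satisfies `γ · rβ/(2β+1) = r/2`, so the logarithm enters as `(√t)^r`. -/
lemma rate_eq {r β L N t : ℝ} (hβ : 0 < β) (hL : 0 < L) (hN : 0 < N) (ht : 0 ≤ t) :
    L ^ (r / (2 * β + 1)) * (t ^ ((2 * β + 1) / (2 * β)) / N) ^ (r * β / (2 * β + 1))
      = (L ^ (1 / (2 * β + 1)) * N ^ (-(β / (2 * β + 1)))) ^ r * Real.sqrt t ^ r := by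
  rw [Real.mul_rpow (by positivity) (by positivity), Real.div_rpow (by positivity) hN.le,
    ← Real.rpow_mul hL.le, ← Real.rpow_mul hN.le, ← Real.rpow_mul ht, Real.sqrt_eq_rpow,
    ← Real.rpow_mul ht, div_eq_mul_inv (t ^ _), ← Real.rpow_neg hN.le]
  have e1 : (2 * β + 1) / (2 * β) * (r * β / (2 * β + 1)) = 1 / 2 * r := by field_simp
  have e2 : 1 / (2 * β + 1) * r = r / (2 * β + 1) := by ring
  have e3 : -(β / (2 * β + 1)) * r = -(r * β / (2 * β + 1)) := by ring
  rw [e1, e2, e3]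
  ring

/-- The `(2β+1)`-th root of `hMh` says `N h ≥ M^(1/(2β+1)) ρ⁻²` with `ρ = L^(1/(2β+1))
N^(-β/(2β+1))`. -/
lemma one_le_of_bandwidth {β L M N h c : ℝ} (hβ : 0 < β) (hL : 0 < L) (hM : 0 < M) (hN : 0 < N)
    (hh : 0 < h) (hc : 0 < c) (hMh : M ≤ N * h ^ (2 * β + 1) * L ^ 2) :
    1 ≤ (N * h / c) * (c / M ^ (1 / (2 * β + 1))
      * (L ^ (1 / (2 * β + 1)) * N ^ (-(β / (2 * β + 1)))) ^ 2) := by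
  have h2 : 0 < 2 * β + 1 := by positivity
  have h1 : M ^ (1 / (2 * β + 1)) ≤ N ^ (1 / (2 * β + 1)) * h * (L ^ (1 / (2 * β + 1))) ^ 2 := by
    refine (Real.rpow_le_rpow hM.le hMh (by positivity)).trans (le_of_eq ?_)
    rw [Real.mul_rpow (by positivity) (by positivity), Real.mul_rpow hN.le (by positivity),
      ← Real.rpow_mul hh.le, mul_one_div_cancel h2.ne', Real.rpow_one, ← Real.rpow_natCast,
      ← Real.rpow_natCast, ← Real.rpow_mul hL.le, ← Real.rpow_mul hL.le, mul_comm (_ : ℝ) (1 / _)]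
  have h3 : N * (N ^ (-(β / (2 * β + 1)))) ^ 2 = N ^ (1 / (2 * β + 1)) := by
    rw [← Real.rpow_natCast, ← Real.rpow_mul hN.le]
    nth_rewrite 1 [← Real.rpow_one N]
    rw [← Real.rpow_add hN]
    congr 1
    push_cast
    field_simp
    ring
  have hMe : 0 < M ^ (1 / (2 * β + 1)) := by positivity
  have e : (N * h / c) * (c / M ^ (1 / (2 * β + 1))
      * (L ^ (1 / (2 * β + 1)) * N ^ (-(β / (2 * β + 1)))) ^ 2)
      = (N * (N ^ (-(β / (2 * β + 1)))) ^ 2) * h * (L ^ (1 / (2 * β + 1))) ^ 2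
        / M ^ (1 / (2 * β + 1)) := by
    field_simp
  rw [e, h3, le_div_iff₀ hMe, one_mul]
  exact h1

lemma one_le_of_max_bandwidth {β L N h c cH : ℝ} (hβ : 0 < β) (hL : 0 < L) (hN : 0 < N)
    (hc : 0 < c) (hcH : 0 < cH) (hh : cH * N ^ (-(1 / (2 * β + 1))) ≤ h) :
    1 ≤ (N * h / c) * (c / (cH * (L ^ (1 / (2 * β + 1))) ^ 2)
      * (L ^ (1 / (2 * β + 1)) * N ^ (-(β / (2 * β + 1)))) ^ 2) := by
  have h3 : N * (N ^ (-(β / (2 * β + 1)))) ^ 2 = N ^ (1 / (2 * β + 1)) := by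
    rw [← Real.rpow_natCast, ← Real.rpow_mul hN.le]
    nth_rewrite 1 [← Real.rpow_one N]
    rw [← Real.rpow_add hN]
    congr 1
    push_cast
    field_simp
    ring
  have hLe : 0 < L ^ (1 / (2 * β + 1)) := by positivity
  have e : (N * h / c) * (c / (cH * (L ^ (1 / (2 * β + 1))) ^ 2)
      * (L ^ (1 / (2 * β + 1)) * N ^ (-(β / (2 * β + 1)))) ^ 2)
      = h * (N * (N ^ (-(β / (2 * β + 1)))) ^ 2) / cH := by
    field_simp
  rw [e, h3, le_div_iff₀ hcH, one_mul]
  rw [Real.rpow_neg hN.le, ← div_eq_mul_inv, div_le_iff₀ (by positivity)] at hh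
  exact hh

end LocPoly

/-! ### The adaptive rate -/

set_option maxHeartbeats 1000000 in
theorem mainTheorem8
    (ℓ : ℕ) (β r vmin vmax wmax lam₀ a₀ : ℝ)
    (hβ : (ℓ : ℝ) < β ∧ β ≤ ℓ + 1) (hr : 0 < r)
    (hvmin : 0 < vmin) (hvmax : vmin ≤ vmax) (hlam₀ : 0 < lam₀) (ha₀ : 0 < a₀) :
    ∃ C : ℝ, 0 < C ∧
      ∀ (L x α μ u₀ u s₁ Cw cH : ℝ) (δ : ℕ → ℝ) (S : (n : ℕ) → LocPoly.Scheme n),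
        0 < L → x ∈ Set.Ioo (0 : ℝ) 1 → α ∈ Set.Ioc (0 : ℝ) 1 → μ ∈ Set.Ioo (0 : ℝ) (1 / 4) →
        1 < u₀ → u₀ ≤ u → 0 < s₁ → 0 < Cw → 0 < cH →
        (∀ n, δ n ∈ Set.Ico (0 : ℝ) 1) →
        (δ =o[atTop] fun n : ℕ => 1 / Real.log n) →
        (∀ᶠ n in atTop, (S n).CondBasic) →
        (∀ᶠ n : ℕ in atTop, cH * (n : ℝ) ^ (-(1 / (2 * β + 1))) ≤ (S n).h (S n).K) →
        (∀ᶠ n in atTop, (S n).CondB ℓ x u₀ u) →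
        (∀ᶠ n in atTop, (S n).CondD ℓ x) →
        (∀ᶠ n in atTop, (S n).CondLoc ℓ) →
        (∀ᶠ n in atTop, (S n).CondPC ℓ x r α) →
        (∀ᶠ n in atTop, (S n).CondCrit ℓ r α μ u) →
        (∀ᶠ n in atTop, (S n).CondS (δ n)) →
        (∀ᶠ n in atTop, (S n).CondS1 vmin vmax) →
        (∀ᶠ n in atTop, (S n).CondLp1 ℓ x lam₀ vmax) →
        (∀ᶠ n in atTop, (S n).CondLp2 a₀) →
        (∀ᶠ n in atTop, (S n).CondLp3 x) →
        (∀ᶠ n in atTop, (S n).CondLp4 wmax) →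
        (∀ᶠ n in atTop, (S n).CondW) →
        (∀ᶠ n in atTop, (S n).CondProd) →
        ∃ e : ℕ → ℝ, Tendsto e atTop (𝓝 0) ∧
          ∀ᶠ n in atTop, ∀ f ∈ LocPoly.HolderClass ℓ β L,
            (S n).FirstAccepted ℓ x f Cw →
            (S n).CondSk1 ℓ x s₁ ((S n).oracleIndex ℓ x f Cw) →
            ∫⁻ y, ENNReal.ofReal (|f x - (S n).fhat ℓ x y| ^ r) ∂(S n).trueLaw f
              ≤ ENNReal.ofReal (C * L ^ (r / (2 * β + 1)) *
                  (Real.log n ^ ((2 * β + 1) / (2 * β)) / n) ^ (r * β / (2 * β + 1)) *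
                  (1 + e n)) := by
  have hβ0 : 0 < β := lt_of_le_of_lt (Nat.cast_nonneg ℓ) hβ.1
  have hvm : 0 < vmax := hvmin.trans_le hvmax
  refine ⟨1, one_pos, ?_⟩
  intro L x α μ u₀ u s₁ Cw cH δ S hL hx hα hμ hu₀ hu _ hCw hcH hδ hδo hBasic hcHK hB _ _ hPC hCrit
    hCS hS1 hLp1 hLp2 hLp3 _ hW hProd
  have hu1 : 1 < u := hu₀.trans_le hu
  have hlu₀ : 0 < Real.log u₀ := Real.log_pos hu₀
  set aK : ℝ := 1 + 2 / Real.log u₀ with haK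
  have haK0 : 0 < aK := by positivity
  obtain ⟨A₀, hA₀, hcritle⟩ := LocPoly.exists_theoreticalCrit_le (p := ℓ + 1) hr hα.1 hμ.1 hu1.le haK0
  set c : ℝ := vmax * u / lam₀ with hc
  have hc0 : 0 < c := by have := one_pos.trans hu1; positivity
  -- Chosen so that the logarithmic term of the risk gets the coefficient `1/2`; the other half pays
  -- for the bounded terms. `M` below is the threshold that forces `κ^(-1/2) ≤ Q₁ ρ`.
  set Q₁ : ℝ := 2 ^ (-(1 / r)) / (3 * Real.sqrt A₀) with hQ₁
  have hQ₁0 : 0 < Q₁ := by positivity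
  have hQ₁r : 3 ^ r * Q₁ ^ r * Real.sqrt A₀ ^ r = 1 / 2 := by
    rw [← Real.mul_rpow (by positivity) hQ₁0.le, ← Real.mul_rpow (by positivity) (by positivity)]
    have : 3 * Q₁ * Real.sqrt A₀ = 2 ^ (-(1 / r)) := by
      rw [hQ₁]
      have := (Real.sqrt_pos.2 hA₀).ne'
      field_simp
    rw [this, ← Real.rpow_mul zero_le_two]
    have : -(1 / r) * r = -1 := by field_simp
    rw [this, Real.rpow_neg_one]
    norm_num
  set M : ℝ := (c / Q₁ ^ 2) ^ (2 * β + 1) with hM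
  have hM0 : 0 < M := by positivity
  have hcM : c / M ^ (1 / (2 * β + 1)) = Q₁ ^ 2 := by
    rw [hM, ← Real.rpow_mul (by positivity), mul_one_div_cancel (by positivity), Real.rpow_one]
    field_simp
  set c₂ : ℝ := vmax / lam₀ with hc₂
  have hc₂0 : 0 < c₂ := by positivity
  set Q₂ : ℝ := Real.sqrt (c₂ / (cH * (L ^ (1 / (2 * β + 1))) ^ 2)) with hQ₂
  have hQ₂0 : 0 < Q₂ := by positivity
  have hQ₂sq : Q₂ ^ 2 = c₂ / (cH * (L ^ (1 / (2 * β + 1))) ^ 2) := Real.sq_sqrt (by positivity)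
  obtain ⟨CD, hCD0, hCD⟩ := lintegral_abs_rpow_gaussianReal_le hr
    (c := Real.sqrt (2 * a₀ / vmin * M) + Cw * Real.sqrt 2) (d := Real.sqrt 2)
    (by positivity) (by positivity)
  -- Bound on the propagation moment uniform in `n`: `1/(1-δ) ≤ 2` in the first exponential, `k
  -- (ℓ+1) ≤ aK (ℓ+1) log n` in the second.
  set b : ℝ := |α * LocPoly.chiSqMoment (ℓ + 1) r|
    + Real.exp (2 * (2 * a₀ / vmin * M)) * Real.exp (2 * (aK * (ℓ + 1))) with hb
  have hb0 : 0 ≤ b := by positivity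
  have hlog : Tendsto (fun n : ℕ => Real.log n) atTop atTop :=
    Real.tendsto_log_atTop.comp tendsto_natCast_atTop_atTop
  have hsqrt : Tendsto (fun n : ℕ => Real.sqrt (Real.log n) ^ r) atTop atTop :=
    (tendsto_rpow_atTop hr).comp (Real.tendsto_sqrt_atTop.comp hlog)
  refine ⟨fun _ => 0, tendsto_const_nhds, ?_⟩
  filter_upwards [hBasic, hcHK, hB, hPC, hCrit, hCS, hS1, hLp1, hLp2, hLp3, hW, hProd,
    eventually_gt_atTop 0, hlog.eventually_ge_atTop 1,
    hlog.eventually_ge_atTop (Real.log (2 * vmax / (lam₀ * vmin))),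
    hsqrt.eventually_ge_atTop (2 * (3 ^ r * Q₁ ^ r * (b + CD))),
    hsqrt.eventually_ge_atTop (3 ^ r * Q₂ ^ r * (b + CD)),
    hδo.bound (half_pos one_pos)] with n hBasic hcHK hB hPC hCrit hCS hS1 hLp1 hLp2 hLp3 hW hProd
    hn hlog1 hlogc hs₁ hs₂ hδb
  intro f hf hfa _
  have hN : (0 : ℝ) < n := by exact_mod_cast hn
  have hδ0 := (hδ n).1
  have hδt : δ n * Real.log n ≤ 1 / 2 := by
    rw [Real.norm_of_nonneg hδ0, Real.norm_of_nonneg (by positivity), ← div_eq_mul_one_div,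
      le_div_iff₀ (by linarith)] at hδb
    exact hδb
  have hδh : δ n ≤ 1 / 2 := (le_mul_of_one_le_right hδ0 hlog1).trans hδt
  have hKlog : ((S n).K : ℝ) ≤ aK * Real.log n := by
    have h1 := LocPoly.Scheme.pow_le_of_condB hBasic hB hS1 hLp1 hn hvmin hvm hlam₀ hu₀
    have h2 := Real.log_le_log (by positivity) h1
    rw [Real.log_pow, Real.log_mul (by positivity) hN.ne', Nat.cast_sub hBasic.1, Nat.cast_one] at h2
    have h3 : ((S n).K : ℝ) - 1 ≤ 2 * Real.log n / Real.log u₀ := by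
      rw [le_div_iff₀ hlu₀]
      linarith
    have e : aK * Real.log n = Real.log n + 2 * Real.log n / Real.log u₀ := by rw [haK]; ring
    linarith
  set ρ : ℝ := L ^ (1 / (2 * β + 1)) * (n : ℝ) ^ (-(β / (2 * β + 1))) with hρ
  have hρ0 : 0 < ρ := by positivity
  have hrate : 1 * L ^ (r / (2 * β + 1)) *
      (Real.log n ^ ((2 * β + 1) / (2 * β)) / n) ^ (r * β / (2 * β + 1)) * (1 + 0)
      = ρ ^ r * Real.sqrt (Real.log n) ^ r := by
    rw [one_mul, add_zero, mul_one, LocPoly.rate_eq hβ0 hL hN (by linarith)]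
  rw [hrate]
  obtain ⟨k, hk, hkM, hknext⟩ := LocPoly.Scheme.exists_reference_scale hBasic.1
    fun k => n * (S n).h k ^ (2 * β + 1) * L ^ 2 ≤ M
  have hk' := Finset.mem_Icc.1 hk
  have hbk : α * LocPoly.chiSqMoment (ℓ + 1) r + Real.exp (2 * a₀ / vmin * M / (1 - δ n))
      * (1 / Real.sqrt (1 - δ n ^ 2)) ^ (k * (ℓ + 1)) ≤ b := by
    have h1 : (1 / Real.sqrt (1 - δ n ^ 2)) ^ (k * (ℓ + 1)) ≤ Real.exp (2 * (aK * (ℓ + 1))) := by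
      refine LocPoly.one_div_sqrt_pow_le hδ0 hδh (t := Real.log n) ?_ (by positivity) (by linarith)
      push_cast
      have : (k : ℝ) ≤ (S n).K := by exact_mod_cast hk'.2
      exact (mul_le_mul_of_nonneg_right (this.trans hKlog) (by positivity)).trans
        (le_of_eq (by ring))
    have hdiv : ∀ t : ℝ, 0 ≤ t → t / (1 - δ n) ≤ 2 * t := fun t ht => by
      rw [div_le_iff₀ (by linarith)]
      nlinarith
    have h2 := hdiv (2 * a₀ / vmin * M) (by positivity)
    have h3 := le_abs_self (α * LocPoly.chiSqMoment (ℓ + 1) r)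
    have h4 : 0 ≤ (1 / Real.sqrt (1 - δ n ^ 2)) ^ (k * (ℓ + 1)) := by positivity
    exact add_le_add h3 (mul_le_mul (Real.exp_le_exp.2 h2) h1 h4 (Real.exp_pos _).le)
  have hrisk : ∀ κ zz : ℝ, 0 < κ →
      (∀ d : Fin (ℓ + 1) → ℝ, κ * d 0 ^ 2 ≤ d ⬝ᵥ ((S n).B ℓ x k *ᵥ d)) →
      (k < (S n).K → (S n).z k ≤ zz) → ∀ Q, 0 < Q → 1 ≤ κ * (Q ^ 2 * ρ ^ 2) →
      ∫⁻ y, ENNReal.ofReal (|f x - (S n).fhat ℓ x y| ^ r) ∂(S n).trueLaw f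
        ≤ ENNReal.ofReal (3 ^ r * (Q ^ r * ρ ^ r) * (Real.sqrt zz ^ r + b + CD)) := by
    intro κ zz hκ hquad hz Q hQ hκQ
    have h1 : 1 / Real.sqrt κ ≤ Q * ρ :=
      LocPoly.one_div_sqrt_le hκ (by positivity) (by rw [mul_pow]; exact hκQ)
    refine (LocPoly.Scheme.risk_le_of_reference hr hα.1.le hβ.1 hL.le hx hn hvmin hvm hlam₀ ha₀ hCw
      hδ0 (hδ n).2 hBasic hPC hCS hS1 hLp1 hLp2 hLp3 hW hProd hf hfa hk hkM hκ hquad hz hCD0 hCD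
      hbk hb0).trans (ENNReal.ofReal_le_ofReal ?_)
    rw [← Real.mul_rpow hQ.le hρ0.le]
    gcongr
  have hρr : 0 < ρ ^ r := by positivity
  rcases hk'.2.lt_or_eq with hlt | heq
  · have hk1 : k + 1 ∈ Finset.Icc 1 (S n).K := Finset.mem_Icc.2 ⟨by omega, hlt⟩
    have hh := hBasic.h_pos hn hk1
    have hMh := not_le.1 (hknext hlt)
    have hκ : 0 < n * (S n).h (k + 1) / c := by positivity
    -- Scale `k` inherits the information of scale `k + 1` up to the factor `u`, which is why `c`
    -- contains `u`.
    have hquad : ∀ d : Fin (ℓ + 1) → ℝ,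
        n * (S n).h (k + 1) / c * d 0 ^ 2 ≤ d ⬝ᵥ ((S n).B ℓ x k *ᵥ d) := fun d => by
      have h1 := hLp1.le_quadForm hBasic hn hlam₀ hvm hk1 d
      have h2 := (hB (k + 1) (by omega) hlt).2.dotProduct_mulVec_nonneg d
      rw [Matrix.sub_mulVec, dotProduct_sub, Matrix.smul_mulVec, dotProduct_smul, star_trivial,
        smul_eq_mul, sub_nonneg, Nat.add_sub_cancel] at h2
      have hu0 : 0 < u := one_pos.trans hu1
      have e : n * (S n).h (k + 1) / c * d 0 ^ 2
          = (n * (S n).h (k + 1) * lam₀ / vmax * d 0 ^ 2) / u := by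
        rw [hc]
        field_simp
      rw [e, div_le_iff₀ hu0, mul_comm (_ ⬝ᵥ _)]
      exact h1.trans h2
    have hz : k < (S n).K → (S n).z k ≤ A₀ * Real.log n := fun _ =>
      (hCrit k hk'.1 hlt).trans (hcritle _ _ _ hlog1 hKlog)
    have hone := LocPoly.one_le_of_bandwidth hβ0 hL hM0 hN hh hc0 hMh.le
    rw [hcM] at hone
    refine (hrisk _ _ hκ hquad hz Q₁ hQ₁0 hone).trans (ENNReal.ofReal_le_ofReal ?_)
    rw [Real.sqrt_mul hA₀.le, Real.mul_rpow (Real.sqrt_nonneg _) (Real.sqrt_nonneg _)]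
    calc 3 ^ r * (Q₁ ^ r * ρ ^ r) * (Real.sqrt A₀ ^ r * Real.sqrt (Real.log n) ^ r + b + CD)
        = ρ ^ r * ((3 ^ r * Q₁ ^ r * Real.sqrt A₀ ^ r) * Real.sqrt (Real.log n) ^ r
          + 3 ^ r * Q₁ ^ r * (b + CD)) := by ring
      _ ≤ ρ ^ r * Real.sqrt (Real.log n) ^ r := by
          rw [hQ₁r]
          refine mul_le_mul_of_nonneg_left ?_ hρr.le
          linarith
  · have hh := hBasic.h_pos hn hk
    have hκ : 0 < n * (S n).h k / c₂ := by positivity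
    have hquad : ∀ d : Fin (ℓ + 1) → ℝ,
        n * (S n).h k / c₂ * d 0 ^ 2 ≤ d ⬝ᵥ ((S n).B ℓ x k *ᵥ d) := fun d => by
      refine le_trans (le_of_eq ?_) (hLp1.le_quadForm hBasic hn hlam₀ hvm hk d)
      rw [hc₂]
      field_simp
    have hone := LocPoly.one_le_of_max_bandwidth hβ0 hL hN hc₂0 hcH (h := (S n).h k)
      (by rw [heq]; exact hcHK)
    rw [← hQ₂sq] at hone
    -- At the largest scale no later one can be selected, so the critical value is replaced by `0`.
    -- The remaining terms have no logarithm, and `√(log n)^r` dominates them.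
    refine (hrisk _ 0 hκ hquad (fun h => absurd heq h.ne) Q₂ hQ₂0 hone).trans
      (ENNReal.ofReal_le_ofReal ?_)
    rw [Real.sqrt_zero, Real.zero_rpow hr.ne', zero_add]
    calc 3 ^ r * (Q₂ ^ r * ρ ^ r) * (b + CD) = ρ ^ r * (3 ^ r * Q₂ ^ r * (b + CD)) := by ring
      _ ≤ ρ ^ r * Real.sqrt (Real.log n) ^ r := mul_le_mul_of_nonneg_left hs₂ hρr.le
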